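/- Let $d\ge 0$ be an integer and let $\mathcal A$ be a homogeneous matrix algebra over $\mathbb Z^d$: a unital Banach algebra of matrices indexed by $\mathbb Z^d$, continuously embedded in $\mathcal B(\ell^2(\mathbb Z^d))$ (with matrix multiplication and the identity matrix as unit), on which the maps $\chi_t(A)(k,l)=e^{2\pi i (k-l)\cdot t}A(k,l)$, $t\in\mathbb R^d$, act and are uniformly bounded. Assume that the translation operators $T_k$, $(T_kx)(l)=x(l-k)$, $k\in\mathbb Z^d$, belong to $\mathcal A$ and that $\sup_k\|T_k\|_{\mathcal A}<\infty$. Let $\delta_1,\dots,\delta_d$ be the generators of $\chi$, i.e. $\delta_j(A)=\lim_{h\to0}\bigl(\chi_{he_j}(A)-A\bigr)/h$, with domain the set of all $A\in\mathcal A$ for which this limit exists in the norm of $\mathcal A$; its matrix entries are $\delta_j(A)(k,l)=2\pi i(k_j-l_j)A(k,l)$. Let $M=(M_k)_{k\ge0}$ be a sequence of positive numbers with $M_0=1$. The Carleman class $C_M(\mathcal A)$ is the set of all $A\in\mathcal A$ for which $\delta^\alpha(A)$ exists for every multi-index $\alpha$ and for which there is an $r>0$ with $\sup_{\alpha}\|\delta^\alpha(A)\|_{\mathcal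 A}/(r^{|\alpha|}M_{|\alpha|})<\infty$. It is called nontrivial if $\mathcal A\ne\bigcap_{j=1}^d\ker\delta_j$. It is inverse-closed in $\mathcal A$ if $A\in C_M(\mathcal A)$ and $A^{-1}\in\mathcal A$ imply $A^{-1}\in C_M(\mathcal A)$. Call a sequence $(u_k)$ almost increasing if there is a constant $C>0$ with $u_k\le C\,u_l$ for all $1\le k<l$. Let $M^c$ be the log-convex regularization of $M$, i.e. the largest sequence $N$ of nonnegative numbers with $N_k\le M_k$ for all $k\ge 0$ and $N_{k}^2\le N_{k-1}N_{k+1}$ for all $k\ge1$. Assume that $C_M(\mathcal A)$ is nontrivial. Then: 1. $C_M(\mathcal A)$ is inverse-closed in $\mathcal A$ if and only if $(M^c_k/k!)^{1/k}$ is almost increasing. 2. If $(M_k/k!)^{1/k}$ is almost increasing, then $C_M(\mathcal A)$ is inverse-closed in $\mathcal A$. 3. In particular, if $M$ is logarithmically convex ($M=M^c$), then $C_M(\mathcal A)$ is inverse-closed in $\mathcal A$ if and only if $(M_k/k!)^{1/k}$ is almost increasing. -/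

import Mathlib

/-- The Hilbert space `ℓ²(ℤᵈ)`. -/
abbrev EllTwo (d : ℕ) : Type := lp (fun _ : Fin d → ℤ => ℂ) 2

/-- The bounded operators on `ℓ²(ℤᵈ)`. -/
abbrev BoundedOp (d : ℕ) : Type := EllTwo d →L[ℂ] EllTwo d

/-- The matrix entry `T(k, l)` of a bounded operator with respect to the standard basis. -/
noncomputable def opEntry {d : ℕ} (T : BoundedOp d) (k l : Fin d → ℤ) : ℂ :=
  (T (lp.single 2 l (1 : ℂ)) : EllTwo d) k

/-- `S = χ_t(T) = M_t T M_{-t}`, where `(M_t x)(k) = e^{2πi k·t} x(k)`; in matrix entries,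
`S(k, l) = e^{2πi (k - l)·t} T(k, l)`. -/
def IsModulationConj {d : ℕ} (t : Fin d → ℝ) (T S : BoundedOp d) : Prop :=
  ∀ k l : Fin d → ℤ,
    opEntry S k l =
      Complex.exp (2 * Real.pi * Complex.I * ∑ j, ((k j - l j : ℤ) : ℂ) * (t j : ℂ)) *
        opEntry T k l

/-- `T = T_k` is the translation operator, `(T_k x)(l) = x(l - k)`. -/
def IsTranslation {d : ℕ} (k : Fin d → ℤ) (T : BoundedOp d) : Prop :=
  ∀ (x : EllTwo d) (l : Fin d → ℤ), (T x) l = x (l - k)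

section MatrixAlgebra

variable {d : ℕ} {A : Type*} [NormedRing A] [NormedAlgebra ℂ A]

/-- A Banach algebra `A` (completeness is assumed where this is used), realised by the embedding
`ι` as an algebra of matrices over `ℤᵈ`, is a homogeneous matrix algebra: it is continuously
embedded in the bounded operators on `ℓ²(ℤᵈ)`, and `χ = (χ_t)` acts on it by uniformly bounded
maps. -/
structure IsHomogeneousMatrixAlgebra (ι : A →ₐ[ℂ] BoundedOp d) : Prop where
  injective : Function.Injective ι
  continuous : Continuous ι
  bounded_action : ∃ C : ℝ, ∀ (t : Fin d → ℝ) (a : A),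
    ∃ b : A, IsModulationConj t (ι a) (ι b) ∧ ‖b‖ ≤ C * ‖a‖

/-- All translation operators belong to `A`, with uniformly bounded norms. -/
def HasBoundedTranslations (ι : A →ₐ[ℂ] BoundedOp d) : Prop :=
  ∃ C : ℝ, ∀ k : Fin d → ℤ, ∃ b : A, IsTranslation k (ι b) ∧ ‖b‖ ≤ C

/-- `a` is in the domain of the `j`-th generator `δ_j` of the group `χ` on `A`, and `δ_j(a) = b`:
the norm limit of `(χ_{h e_j}(a) - a) / h` as `h → 0` exists in `A` and equals `b`. -/
def IsGenerator (ι : A →ₐ[ℂ] BoundedOp d) (j : Fin d) (a b : A) : Prop :=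
  ∃ ψ : ℝ → A, (∀ h : ℝ, IsModulationConj (Pi.single j h) (ι a) (ι (ψ h))) ∧
    HasDerivAt ψ b 0

/-- `a` is in the domain of `δ^α` for every multi-index `α`, and `δ^α(a) = D α`. -/
def IsDerivativeFamily (ι : A →ₐ[ℂ] BoundedOp d) (a : A) (D : (Fin d → ℕ) → A) : Prop :=
  D 0 = a ∧ ∀ (α : Fin d → ℕ) (j : Fin d), IsGenerator ι j (D α) (D (α + Pi.single j 1))

/-- `C_{r,M}(A)`: all `δ^α(a)` exist, and `sup_α ‖δ^α(a)‖ / (r^|α| M_|α|)` is finite. -/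
def carlemanSpace (ι : A →ₐ[ℂ] BoundedOp d) (r : ℝ) (M : ℕ → ℝ) : Set A :=
  {a | ∃ D : (Fin d → ℕ) → A, IsDerivativeFamily ι a D ∧
    ∃ C : ℝ, ∀ α : Fin d → ℕ, ‖D α‖ / (r ^ (∑ j, α j) * M (∑ j, α j)) ≤ C}

/-- The Carleman class `C_M(A)`. -/
def carlemanClass (ι : A →ₐ[ℂ] BoundedOp d) (M : ℕ → ℝ) : Set A :=
  ⋃ r ∈ Set.Ioi (0 : ℝ), carlemanSpace ι r M

/-- The intersection of the kernels of `δ_1, …, δ_d`. -/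
def commonKernel (ι : A →ₐ[ℂ] BoundedOp d) : Set A :=
  {a | ∀ j : Fin d, IsGenerator ι j a 0}

/-- The Carleman classes over `A` are nontrivial: `A` is not the common kernel of the `δ_j`. -/
def CarlemanNontrivial (ι : A →ₐ[ℂ] BoundedOp d) : Prop :=
  commonKernel ι ≠ Set.univ

end MatrixAlgebra

/-- A subset `S` of a ring is inverse-closed: if `a ∈ S` is invertible in the ring, then
`a⁻¹ ∈ S`. -/
def IsInverseClosed {R : Type*} [Ring R] (S : Set R) : Prop :=
  ∀ u : Rˣ, (u : R) ∈ S → ((u⁻¹ : Rˣ) : R) ∈ S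

/-- A defining sequence: positive numbers with `M_0 = 1`. -/
def IsDefiningSequence (M : ℕ → ℝ) : Prop :=
  M 0 = 1 ∧ ∀ k, 0 < M k

/-- Logarithmic convexity of a sequence. -/
def IsLogConvexSeq (N : ℕ → ℝ) : Prop :=
  ∀ k, N (k + 1) ^ 2 ≤ N k * N (k + 2)

/-- The log-convex regularization `M^c`: the largest nonnegative logarithmically convex sequence
below `M`. -/
noncomputable def logConvexReg (M : ℕ → ℝ) (k : ℕ) : ℝ :=
  sSup {x : ℝ | ∃ N : ℕ → ℝ, (∀ i, 0 ≤ N i) ∧ (∀ i, N i ≤ M i) ∧ IsLogConvexSeq N ∧ N k = x}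

/-- `u_k ≤ C u_l` for all `1 ≤ k < l` (the index `0` is left out, because the sequences of interest
are `k`-th roots). -/
def IsAlmostIncreasing (u : ℕ → ℝ) : Prop :=
  ∃ C : ℝ, 0 < C ∧ ∀ k l : ℕ, 1 ≤ k → k < l → u k ≤ C * u l

/-- The sequence `(M_k / k!)^{1/k}`. -/
noncomputable def rootSeq (M : ℕ → ℝ) (k : ℕ) : ℝ :=
  (M k / (k.factorial : ℝ)) ^ (1 / (k : ℝ))

/-!
The algebra is studied through matrix entries: `χ_t` multiplies the diagonal `n = k - l` by
`e^{2πi n·t}` and `δ^α` multiplies it by `∏ⱼ (2πi nⱼ)^{αⱼ}`. A relation between elements only has to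
be checked on entries (`entry_ext`), and an entrywise derivative whose orbit under `χ` is
norm-continuous is a derivative in norm (`EntrywiseDeriv.isGenerator`).

*Almost increasing roots suffice* (`isInverseClosed_of_isAlmostIncreasing`). The inverse `b` of a
smooth invertible `a` is smooth, and the Leibniz rule for `a b = 1` expresses `a δ^α(b)` by
derivatives of `b` of lower order. Fix the order `n` and put `ρ = r (M_n / n!)^{1/n}`. Almost
increase means that the derivatives of `a` of order `i ≤ n` are bounded by a constant times
`i! (c ρ)^i`. The recursion then has a geometric majorant (`le_of_inverse_recursion`), which at the
order `n` is the required bound. Logarithmic convexity plays no role here.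

*The classes of `M` and `M^c` coincide* (`carlemanClass_logConvexReg`). This is a Kolmogorov
inequality for `δ^α(a)` (`norm_le_logConvexReg`). A smooth cut-off in frequency at scale `N` is an
average of the operators `χ_t`. Bernstein's inequality bounds the low part of `δ^α(a)` by
derivatives of lower order and Favard's inequality bounds the rest by derivatives of higher order,
with constants geometric in the difference of the orders. If `N` is chosen so that both parts are
of the size of `δ^α(a)`, one obtains a geometric sequence which lies below `M` and has the size of
`δ^α(a)` at the index `|α|`. Geometric sequences are log-convex, so it lies below `M^c` as well.
Together with the first part, applied to `M^c`, this gives one direction of the equivalence.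

*Almost increasing roots are necessary* (`isAlmostIncreasing_of_isInverseClosed`). A series
`f = ∑ₘ wₘ T_{νₘ eⱼ}` of translations with positive coefficients is chosen in the class so that its
`m`-th term has an `m`-th derivative as large as `M^c_m` permits (`exists_weights`). The Neumann
series for `(1 - f)⁻¹` has nonnegative entries, hence its diagonal `p νₘ eⱼ` is at least `wₘ^p`. If
the inverse is in the class, this single diagonal produces a geometric sequence below a multiple of
`M`, hence of `M^c`; at the index `p m` it yields
`(M^c_m)^{1/m} ≤ G p⁻¹ (M^c_{pm})^{1/(pm)}`. Since `(M^c_k)^{1/k}` increases, that is almost increase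
(`isAlmostIncreasing_of_multiples`).

The regularization may vanish beyond the index `0`. The class then consists of diagonal matrices
(`entry_eq_zero_of_logConvexReg_eq_zero`), so it is inverse-closed, and the roots of `M^c` are
trivially almost increasing.
-/

/-! ### The logarithmically convex regularization -/

section LogConvex

variable {M : ℕ → ℝ}

theorem bddAbove_logConvexMinorants (M : ℕ → ℝ) (k : ℕ) :
    BddAbove {x : ℝ | ∃ N : ℕ → ℝ, (∀ i, 0 ≤ N i) ∧ (∀ i, N i ≤ M i) ∧ IsLogConvexSeq N ∧
      N k = x} :=
  ⟨M k, by rintro x ⟨N, -, h, -, rfl⟩; exact h k⟩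

theorem le_logConvexReg {N : ℕ → ℝ} (h0 : ∀ i, 0 ≤ N i) (hNM : ∀ i, N i ≤ M i)
    (hN : IsLogConvexSeq N) (k : ℕ) : N k ≤ logConvexReg M k :=
  le_csSup (bddAbove_logConvexMinorants M k) ⟨N, h0, hNM, hN, rfl⟩

theorem logConvexReg_nonneg (k : ℕ) : 0 ≤ logConvexReg M k :=
  Real.sSup_nonneg (by rintro x ⟨N, h, -, -, rfl⟩; exact h k)

theorem logConvexReg_le (hM : ∀ k, 0 ≤ M k) (k : ℕ) : logConvexReg M k ≤ M k :=
  Real.sSup_le (by rintro x ⟨N, -, h, -, rfl⟩; exact h k) (hM k)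

theorem isLogConvexSeq_logConvexReg : IsLogConvexSeq (logConvexReg M) := by
  intro k
  have h : logConvexReg M (k + 1) ≤ √(logConvexReg M k * logConvexReg M (k + 2)) := by
    refine Real.sSup_le ?_ (Real.sqrt_nonneg _)
    rintro x ⟨N, h0, hNM, hN, rfl⟩
    refine Real.le_sqrt_of_sq_le ((hN k).trans ?_)
    exact mul_le_mul (le_logConvexReg h0 hNM hN _) (le_logConvexReg h0 hNM hN _) (h0 _)
      (logConvexReg_nonneg _)
  calc logConvexReg M (k + 1) ^ 2 ≤ √(logConvexReg M k * logConvexReg M (k + 2)) ^ 2 :=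
        pow_le_pow_left₀ (logConvexReg_nonneg _) h 2
    _ = _ := Real.sq_sqrt (mul_nonneg (logConvexReg_nonneg _) (logConvexReg_nonneg _))

theorem geometric_le_logConvexReg {c q : ℝ} (hc : 0 ≤ c) (hq : 0 ≤ q)
    (h : ∀ n, c * q ^ n ≤ M n) (k : ℕ) : c * q ^ k ≤ logConvexReg M k :=
  le_logConvexReg (N := fun n => c * q ^ n) (fun i => by positivity) h
    (fun i => le_of_eq (by ring)) k

theorem logConvexReg_zero (hM : IsDefiningSequence M) : logConvexReg M 0 = 1 := by
  refine le_antisymm ((logConvexReg_le (fun k => (hM.2 k).le) 0).trans_eq hM.1) ?_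
  have := geometric_le_logConvexReg (M := M) (c := 1) (q := 0) zero_le_one le_rfl (fun n => by
    rcases n with _ | n
    · simp [hM.1]
    · simpa using (hM.2 (n + 1)).le) 0
  simpa using this

theorem logConvexReg_eq_self (hM : ∀ k, 0 ≤ M k) (h : IsLogConvexSeq M) : logConvexReg M = M :=
  funext fun k => le_antisymm (logConvexReg_le hM k) (le_logConvexReg hM (fun _ => le_rfl) h k)

/-- A zero beyond the index `0` spreads to all indices `k ≥ 1`. -/
theorem logConvexReg_pos_of_pos (hM : IsDefiningSequence M) {k : ℕ}
    (hk : 0 < logConvexReg M (k + 1)) (n : ℕ) : 0 < logConvexReg M n := by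
  have hc := isLogConvexSeq_logConvexReg (M := M)
  have hpos : ∀ i, 0 < logConvexReg M (i + 1) →
      0 < logConvexReg M i ∧ 0 < logConvexReg M (i + 2) := by
    intro i hi
    have h := (pow_pos hi 2).trans_le (hc i)
    exact ⟨pos_of_mul_pos_left h (logConvexReg_nonneg _),
      pos_of_mul_pos_right h (logConvexReg_nonneg _)⟩
  have hdown : 0 < logConvexReg M 1 := by
    induction k with
    | zero => exact hk
    | succ k ih => exact ih (hpos _ hk).1
  rcases n with _ | n
  · rw [logConvexReg_zero hM]; exact one_pos
  · induction n with
    | zero => exact hdown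
    | succ n ih => exact (hpos _ ih).2

theorem rootSeq_pow (M : ℕ → ℝ) {k : ℕ} (hM : 0 ≤ M k) (hk : 1 ≤ k) :
    M k = k.factorial * rootSeq M k ^ k := by
  rw [rootSeq, one_div, Real.rpow_inv_natCast_pow (by positivity) (by omega)]
  field_simp

theorem rootSeq_nonneg {k : ℕ} (hM : 0 ≤ M k) : 0 ≤ rootSeq M k :=
  Real.rpow_nonneg (by positivity) _

end LogConvex

/-! ### Sequences with almost increasing roots -/

section Roots

variable {N : ℕ → ℝ}

theorem IsLogConvexSeq.monotone_ratio (hN : IsLogConvexSeq N) (hpos : ∀ k, 0 < N k) :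
    Monotone fun k => N (k + 1) / N k :=
  monotone_nat_of_le_succ fun k => by
    rw [div_le_div_iff₀ (hpos k) (hpos (k + 1))]
    have := hN k
    nlinarith

/-- The geometric sequence through the points `m`, `m + 1` of a log-convex sequence supports it
from below. -/
theorem IsLogConvexSeq.support_le (hN : IsLogConvexSeq N) (hpos : ∀ k, 0 < N k) (m k : ℕ) :
    N m * (N (m + 1) / N m) ^ k ≤ N k * (N (m + 1) / N m) ^ m := by
  set μ : ℕ → ℝ := fun k => N (k + 1) / N k with hμ
  have hμpos : ∀ k, 0 < μ k := fun k => div_pos (hpos _) (hpos _)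
  have hstep : ∀ k, N (k + 1) = μ k * N k := fun k => (div_mul_cancel₀ _ (hpos k).ne').symm
  have hmono := hN.monotone_ratio hpos
  change N m * μ m ^ k ≤ N k * μ m ^ m
  rcases le_total m k with h | h
  · induction k, h using Nat.le_induction with
    | base => exact le_rfl
    | succ k hk ih =>
      rw [pow_succ, hstep k]
      have h1 : μ m ≤ μ k := hmono hk
      have h2 := hpos k
      have h3 := hμpos m
      calc N m * (μ m ^ k * μ m) = (N m * μ m ^ k) * μ m := by ring
        _ ≤ (N k * μ m ^ m) * μ k := mul_le_mul ih h1 h3.le (by positivity)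
        _ = _ := by ring
  · induction h using Nat.decreasingInduction with
    | self => exact le_rfl
    | of_succ k hk ih =>
      have h1 : μ k ≤ μ m := hmono hk.le
      have h2 := hpos k
      have h3 := hμpos m
      rw [pow_succ, hstep k] at ih
      refine le_of_mul_le_mul_right ?_ h3
      calc N m * μ m ^ k * μ m ≤ μ k * N k * μ m ^ m := by linarith
        _ ≤ μ m * N k * μ m ^ m := by gcongr
        _ = _ := by ring

/-- This is `N_k^{1/k} ≤ N_{k+1}^{1/(k+1)}` without roots. -/
theorem IsLogConvexSeq.pow_succ_le (hN : IsLogConvexSeq N) (hpos : ∀ k, 0 < N k) (h0 : N 0 = 1)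
    (k : ℕ) : N k ^ (k + 1) ≤ N (k + 1) ^ k := by
  induction k with
  | zero => simp [h0]
  | succ k ih =>
    have h1 := pow_le_pow_left₀ (sq_nonneg _) (hN k) (k + 1)
    rw [mul_pow] at h1
    have hp := hpos (k + 1)
    have hq := hpos (k + 2)
    have h2 := h1.trans (mul_le_mul_of_nonneg_right ih (by positivity))
    refine le_of_mul_le_mul_left ?_ (pow_pos hp k)
    calc N (k + 1) ^ k * N (k + 1) ^ (k + 1 + 1) = (N (k + 1) ^ 2) ^ (k + 1) := by
          rw [← pow_mul, ← pow_add]; congr 1; ring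
      _ ≤ _ := h2

theorem IsLogConvexSeq.rpow_inv_le (hN : IsLogConvexSeq N) (hpos : ∀ k, 0 < N k) (h0 : N 0 = 1)
    {k l : ℕ} (hk : 1 ≤ k) (hkl : k ≤ l) : N k ^ (1 / (k : ℝ)) ≤ N l ^ (1 / (l : ℝ)) := by
  induction l, hkl using Nat.le_induction with
  | base => exact le_rfl
  | succ l hl ih =>
    refine ih.trans ?_
    have h1 := hpos l
    have h2 := hpos (l + 1)
    have hl0 : l ≠ 0 := by omega
    have h := hN.pow_succ_le hpos h0 l
    refine le_of_pow_le_pow_left₀ (n := l * (l + 1)) (by simp [hl0]) (by positivity) ?_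
    rw [pow_mul, one_div, Real.rpow_inv_natCast_pow h1.le hl0, mul_comm l, pow_mul, one_div,
      Real.rpow_inv_natCast_pow h2.le (by omega)]
    exact h

theorem rootSeq_eq_div {k : ℕ} (hpos : 0 < N k) :
    rootSeq N k = N k ^ (1 / (k : ℝ)) / (k.factorial : ℝ) ^ (1 / (k : ℝ)) :=
  Real.div_rpow hpos.le (by positivity) _

/-- It suffices to compare the roots along multiples `p m` of an index `m`: monotonicity of
`N_k^{1/k}` covers the indices in between. -/
theorem isAlmostIncreasing_of_multiples (hN : IsLogConvexSeq N) (hpos : ∀ k, 0 < N k)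
    (h0 : N 0 = 1) {G : ℝ} (hG : 0 < G)
    (h : ∀ m p : ℕ, 1 ≤ m → 1 ≤ p → N m ^ p * (p : ℝ) ^ (p * m) ≤ G ^ (p * m) * N (p * m)) :
    IsAlmostIncreasing (rootSeq N) := by
  refine ⟨2 * G * Real.exp 1, by positivity, fun m l hm hml => ?_⟩
  set p := l / m with hp
  have hp1 : 1 ≤ p := (Nat.one_le_div_iff hm).2 hml.le
  have hpm : p * m ≤ l := Nat.div_mul_le_self l m
  have hl : l ≤ 2 * (p * m) := by
    have h1 := Nat.lt_mul_div_succ l hm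
    have h2 : m ≤ p * m := Nat.le_mul_of_pos_left m hp1
    have h3 : m * (l / m + 1) = p * m + m := by rw [hp]; ring
    omega
  have hpm0 : p * m ≠ 0 := by positivity
  have hm0 : m ≠ 0 := by omega
  have hl0 : l ≠ 0 := by omega
  set v : ℕ → ℝ := fun k => N k ^ (1 / (k : ℝ)) with hv
  have hvpos : ∀ k, 0 < v k := fun k => Real.rpow_pos_of_pos (hpos k) _
  have hvpow : ∀ k, k ≠ 0 → v k ^ k = N k := fun k hk => by
    simp only [hv, one_div]; exact Real.rpow_inv_natCast_pow (hpos k).le hk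
  have h1 : v m * p ≤ G * v (p * m) := by
    refine le_of_pow_le_pow_left₀ hpm0 (by have := hvpos (p * m); positivity) ?_
    rw [mul_pow, mul_pow, hvpow _ hpm0, mul_comm p m, pow_mul (v m), hvpow m hm0, mul_comm m p]
    exact h m p hm hp1
  have h2 : v (p * m) ≤ v l := hN.rpow_inv_le hpos h0 (by omega) hpm
  have hmpos : (0 : ℝ) < m := by positivity
  have hfm : (m : ℝ) / Real.exp 1 ≤ (m.factorial : ℝ) ^ (1 / (m : ℝ)) := by
    refine le_of_pow_le_pow_left₀ hm0 (by positivity) ?_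
    rw [one_div, Real.rpow_inv_natCast_pow (by positivity) hm0, div_pow, ← Real.exp_nat_mul,
      mul_one, div_le_iff₀ (Real.exp_pos _)]
    have := Real.pow_div_factorial_le_exp (m : ℝ) hmpos.le m
    rw [div_le_iff₀ (by positivity)] at this
    linarith
  have hfl : (l.factorial : ℝ) ^ (1 / (l : ℝ)) ≤ l := by
    refine le_of_pow_le_pow_left₀ hl0 (by positivity) ?_
    rw [one_div, Real.rpow_inv_natCast_pow (by positivity) hl0]
    exact_mod_cast Nat.factorial_le_pow l
  rw [rootSeq_eq_div (hpos m), rootSeq_eq_div (hpos l)]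
  change v m / _ ≤ 2 * G * Real.exp 1 * (v l / _)
  have hle1 : v m / (m.factorial : ℝ) ^ (1 / (m : ℝ)) ≤ v m / (m / Real.exp 1) :=
    div_le_div_of_nonneg_left (hvpos m).le (by positivity) hfm
  have hle2 : v l / l ≤ v l / (l.factorial : ℝ) ^ (1 / (l : ℝ)) :=
    div_le_div_of_nonneg_left (hvpos l).le (by positivity) hfl
  refine hle1.trans (le_trans ?_ (mul_le_mul_of_nonneg_left hle2 (by positivity)))
  have hlr : (l : ℝ) ≤ 2 * (p * m) := by exact_mod_cast hl
  have hlpos : (0 : ℝ) < l := by positivity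
  have h3 : v m * p ≤ G * v l := h1.trans (mul_le_mul_of_nonneg_left h2 hG.le)
  have h4 : v m * l ≤ 2 * G * v l * m := by
    calc v m * l ≤ v m * (2 * (p * m)) := mul_le_mul_of_nonneg_left hlr (hvpos m).le
      _ = 2 * (v m * p) * m := by ring
      _ ≤ 2 * (G * v l) * m := by gcongr
      _ = _ := by ring
  rw [div_div_eq_mul_div, ← mul_div_assoc, div_le_div_iff₀ hmpos hlpos]
  calc v m * Real.exp 1 * l = (v m * l) * Real.exp 1 := by ring
    _ ≤ (2 * G * v l * m) * Real.exp 1 := by gcongr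
    _ = _ := by ring

/-- Weights `w_m` at integer frequencies `ν_m` whose power moments are controlled by the sequence
`N`, and reach it, up to geometric factors, at the order `m`. The frequencies are the successive
quotients of `N`, divided by the first one and rounded up. -/
theorem exists_weights (hN : IsLogConvexSeq N) (hpos : ∀ k, 0 < N k) {ε : ℝ} (hε : 0 < ε) :
    ∃ (w : ℕ → ℝ) (ν : ℕ → ℕ) (R κ : ℝ), 0 < R ∧ 0 < κ ∧ (∀ m, 0 < w m) ∧
      (∀ m k, w m * (ν m : ℝ) ^ k ≤ ε * (1 / 2) ^ m * (R ^ k * N k)) ∧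
      ∀ m, ε * κ ^ m * N m ≤ w m * (ν m : ℝ) ^ m := by
  set μ : ℕ → ℝ := fun k => N (k + 1) / N k with hμ
  have hμpos : ∀ k, 0 < μ k := fun k => div_pos (hpos _) (hpos _)
  have hmono : Monotone μ := hN.monotone_ratio hpos
  have h0 := hμpos 0
  have hdown : ∀ m, (⌈μ m / μ 0⌉₊ : ℝ) ≤ 2 / μ 0 * μ m := fun m => by
    have h1 := (Nat.ceil_lt_add_one (div_pos (hμpos m) h0).le).le
    have h2 : 1 ≤ μ m / μ 0 := (one_le_div h0).2 (hmono (Nat.zero_le m))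
    calc (⌈μ m / μ 0⌉₊ : ℝ) ≤ μ m / μ 0 + μ m / μ 0 := by linarith
      _ = _ := by ring
  refine ⟨fun m => ε * (1 / 2) ^ m * (N m / μ m ^ m), fun m => ⌈μ m / μ 0⌉₊, 2 / μ 0,
    1 / (2 * μ 0), by positivity, by positivity, fun m => ?_, fun m k => ?_, fun m => ?_⟩
  · have := hμpos m
    have := hpos m
    positivity
  · have hm := hμpos m
    have hNm := hpos m
    have hs := hN.support_le hpos m k
    change N m * μ m ^ k ≤ N k * μ m ^ m at hs
    rw [mul_assoc]
    refine mul_le_mul_of_nonneg_left ?_ (by positivity)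
    calc N m / μ m ^ m * (⌈μ m / μ 0⌉₊ : ℝ) ^ k
        ≤ N m / μ m ^ m * (2 / μ 0 * μ m) ^ k := by gcongr; exact hdown m
      _ = (2 / μ 0) ^ k * ((N m * μ m ^ k) / μ m ^ m) := by rw [mul_pow]; ring
      _ ≤ (2 / μ 0) ^ k * N k := by
        gcongr
        rwa [div_le_iff₀ (by positivity)]
  · have hm := hμpos m
    have hNm := hpos m
    have hle : μ m ^ m / μ 0 ^ m ≤ (⌈μ m / μ 0⌉₊ : ℝ) ^ m := by
      rw [← div_pow]
      gcongr
      exact Nat.le_ceil _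
    calc ε * (1 / (2 * μ 0)) ^ m * N m
        = ε * (1 / 2) ^ m * (N m / μ m ^ m) * (μ m ^ m / μ 0 ^ m) := by
          rw [show 1 / (2 * μ 0) = 1 / 2 / μ 0 by ring, div_pow (1 / 2)]
          field_simp
      _ ≤ _ := by gcongr

end Roots

namespace HomogeneousMatrixAlgebra

open scoped ComplexOrder FourierTransform ContDiff

variable {d : ℕ} {A : Type*} [NormedRing A] [NormedAlgebra ℂ A] {ι : A →ₐ[ℂ] BoundedOp d}

/-! ### Matrix entries -/

/-- The matrix entry `a(k, l)`, as a continuous linear functional on the algebra. -/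
noncomputable def entry (hA : IsHomogeneousMatrixAlgebra ι) (k l : Fin d → ℤ) : A →L[ℂ] ℂ :=
  (lp.evalCLM ℂ (fun _ : Fin d → ℤ => ℂ) 2 k).comp
    ((ContinuousLinearMap.apply ℂ (EllTwo d) (lp.single 2 l (1 : ℂ))).comp
      ⟨ι.toLinearMap, hA.continuous⟩)

variable (hA : IsHomogeneousMatrixAlgebra ι)

theorem entry_eq (k l : Fin d → ℤ) (a : A) : entry hA k l a = opEntry (ι a) k l := rfl

theorem hasSum_opEntry (T : BoundedOp d) (x : EllTwo d) (k : Fin d → ℤ) :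
    HasSum (fun i => opEntry T k i * x i) ((T x : EllTwo d) k) := by
  have h := lp.hasSum_single (E := fun _ : Fin d → ℤ => ℂ) (p := 2) (by simp) x
  have h2 := h.mapL ((lp.evalCLM ℂ (fun _ : Fin d → ℤ => ℂ) 2 k).comp T)
  refine Eq.subst (motive := fun f => HasSum f _) (funext fun i => ?_) h2
  dsimp only [Function.comp_apply]
  have : lp.single 2 i (x i) = (x i) • (lp.single 2 i (1 : ℂ) : EllTwo d) := by
    rw [← lp.single_smul]; simp
  rw [this, map_smul, smul_eq_mul, mul_comm]
  rfl

theorem entry_ext {a b : A} (h : ∀ k l, entry hA k l a = entry hA k l b) : a = b := by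
  apply hA.injective
  ext x k
  refine (hasSum_opEntry (ι a) x k).unique ?_
  simp_rw [← entry_eq hA, h]
  exact hasSum_opEntry (ι b) x k

theorem hasSum_entry_mul (a b : A) (k l : Fin d → ℤ) :
    HasSum (fun i => entry hA k i a * entry hA i l b) (entry hA k l (a * b)) := by
  rw [entry_eq, map_mul]
  exact hasSum_opEntry (ι a) _ k

theorem entry_one (k l : Fin d → ℤ) : entry hA k l 1 = if k = l then 1 else 0 := by
  rw [entry_eq, map_one]
  by_cases h : k = l
  · subst h; simp [opEntry]
  · simp [opEntry, lp.single_apply, h]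

/-! ### The modulation group -/

/-- The character `e^{2πi n·t}`. -/
noncomputable def phase (n : Fin d → ℤ) (t : Fin d → ℝ) : ℂ :=
  Complex.exp (2 * Real.pi * Complex.I * ∑ j, (n j : ℂ) * (t j : ℂ))

theorem phase_zero_left (t : Fin d → ℝ) : phase (0 : Fin d → ℤ) t = 1 := by simp [phase]

theorem phase_zero_right (n : Fin d → ℤ) : phase n 0 = 1 := by simp [phase]

theorem phase_add_left (m n : Fin d → ℤ) (t : Fin d → ℝ) :
    phase (m + n) t = phase m t * phase n t := by
  simp only [phase, ← Complex.exp_add, ← mul_add, ← Finset.sum_add_distrib]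
  congr 2
  refine Finset.sum_congr rfl fun j _ => ?_
  simp only [Pi.add_apply]; push_cast; ring

theorem phase_add_right (n : Fin d → ℤ) (s t : Fin d → ℝ) :
    phase n (s + t) = phase n s * phase n t := by
  simp only [phase, ← Complex.exp_add, ← mul_add, ← Finset.sum_add_distrib]
  congr 2
  refine Finset.sum_congr rfl fun j _ => ?_
  simp only [Pi.add_apply]; push_cast; ring

theorem phase_single (n : Fin d → ℤ) (j : Fin d) (h : ℝ) :
    phase n (Pi.single j h) = Complex.exp (h * (2 * Real.pi * Complex.I * n j)) := by
  have : ∑ i, (n i : ℂ) * ((Pi.single j h : Fin d → ℝ) i : ℂ) = n j * h := by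
    rw [Finset.sum_eq_single j]
    · simp
    · intro i _ hi; simp [hi]
    · simp
  rw [phase, this]; congr 1; ring

theorem isModulationConj_iff (t : Fin d → ℝ) (a b : A) :
    IsModulationConj t (ι a) (ι b) ↔
      ∀ k l, entry hA k l b = phase (k - l) t * entry hA k l a := Iff.rfl

/-- A bound, at least `1`, for the norms of the maps `χ_t`. -/
noncomputable def actionBound : ℝ := max hA.bounded_action.choose 1

theorem one_le_actionBound : 1 ≤ actionBound hA := le_max_right _ _

theorem actionBound_pos : 0 < actionBound hA := one_pos.trans_le (one_le_actionBound hA)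

theorem exists_action (t : Fin d → ℝ) (a : A) :
    ∃ b : A, (∀ k l, entry hA k l b = phase (k - l) t * entry hA k l a) ∧
      ‖b‖ ≤ actionBound hA * ‖a‖ := by
  obtain ⟨b, hb, hn⟩ := hA.bounded_action.choose_spec t a
  exact ⟨b, hb, hn.trans (mul_le_mul_of_nonneg_right (le_max_left _ _) (norm_nonneg a))⟩

/-- The automorphism `χ_t` of the algebra, as a bounded linear map. -/
noncomputable def action (t : Fin d → ℝ) : A →L[ℂ] A :=
  LinearMap.mkContinuous
    { toFun := fun a => (exists_action hA t a).choose
      map_add' := fun a b => entry_ext hA fun k l => by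
        rw [map_add, (exists_action hA t _).choose_spec.1, (exists_action hA t _).choose_spec.1,
          (exists_action hA t _).choose_spec.1, map_add, mul_add]
      map_smul' := fun c a => entry_ext hA fun k l => by
        rw [RingHom.id_apply, map_smul, (exists_action hA t _).choose_spec.1,
          (exists_action hA t _).choose_spec.1, map_smul, smul_eq_mul, smul_eq_mul]
        ring }
    (actionBound hA) fun a => (exists_action hA t a).choose_spec.2

theorem entry_action (t : Fin d → ℝ) (a : A) (k l : Fin d → ℤ) :
    entry hA k l (action hA t a) = phase (k - l) t * entry hA k l a :=
  (exists_action hA t a).choose_spec.1 k l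

theorem norm_action_le (t : Fin d → ℝ) (a : A) : ‖action hA t a‖ ≤ actionBound hA * ‖a‖ :=
  (exists_action hA t a).choose_spec.2

theorem action_zero (a : A) : action hA 0 a = a :=
  entry_ext hA fun k l => by rw [entry_action, phase_zero_right, one_mul]

theorem action_add (s t : Fin d → ℝ) (a : A) :
    action hA (s + t) a = action hA s (action hA t a) :=
  entry_ext hA fun k l => by
    rw [entry_action, entry_action, entry_action, phase_add_right, mul_assoc]

theorem action_mul (t : Fin d → ℝ) (a b : A) :
    action hA t (a * b) = action hA t a * action hA t b := by
  refine entry_ext hA fun k l => ?_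
  rw [entry_action]
  refine ((hasSum_entry_mul hA a b k l).mul_left _).unique ?_
  refine Eq.subst (motive := fun f => HasSum f _) (funext fun i => ?_)
    (hasSum_entry_mul hA (action hA t a) (action hA t b) k l)
  rw [entry_action, entry_action, ← sub_add_sub_cancel k i l, phase_add_left]
  ring

theorem action_one (t : Fin d → ℝ) : action hA t 1 = 1 := by
  refine entry_ext hA fun k l => ?_
  rw [entry_action, entry_one]
  split_ifs with h
  · rw [h, sub_self, phase_zero_left, one_mul]
  · rw [mul_zero]

/-- The elements on which the group `χ` acts norm-continuously. -/
def continuousVectors : Submodule ℂ A where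
  carrier := {a | Continuous fun t => action hA t a}
  add_mem' {a b} ha hb := by
    have : Continuous fun t => action hA t a + action hA t b := Continuous.add ha hb
    simpa using this
  zero_mem' := by simpa using continuous_const
  smul_mem' c a ha := by
    have : Continuous fun t => c • action hA t a := Continuous.const_smul ha c
    simpa using this

theorem mem_continuousVectors {a : A} :
    a ∈ continuousVectors hA ↔ Continuous fun t => action hA t a := Iff.rfl

theorem mul_mem_continuousVectors {a b : A} (ha : a ∈ continuousVectors hA)
    (hb : b ∈ continuousVectors hA) : a * b ∈ continuousVectors hA := by
  rw [mem_continuousVectors] at *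
  simp_rw [action_mul]
  exact ha.mul hb

theorem action_mem_continuousVectors {a : A} (s : Fin d → ℝ) (ha : a ∈ continuousVectors hA) :
    action hA s a ∈ continuousVectors hA := by
  rw [mem_continuousVectors] at *
  simp_rw [← action_add]
  exact ha.comp (continuous_id.add continuous_const)

theorem inv_mem_continuousVectors [CompleteSpace A] (u : Aˣ)
    (hu : (u : A) ∈ continuousVectors hA) : ((u⁻¹ : Aˣ) : A) ∈ continuousVectors hA := by
  rw [mem_continuousVectors] at *
  let v : (Fin d → ℝ) → Aˣ := fun t =>
    ⟨action hA t u, action hA t (u⁻¹ : Aˣ), by rw [← action_mul, u.mul_inv, action_one],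
      by rw [← action_mul, u.inv_mul, action_one]⟩
  have hv : ∀ t, action hA t ((u⁻¹ : Aˣ) : A) = Ring.inverse (action hA t u) := fun t =>
    (Ring.inverse_unit (v t)).symm
  simp_rw [hv]
  rw [continuous_iff_continuousAt]
  intro t
  exact ContinuousAt.comp (f := fun t => action hA t (u : A)) (g := Ring.inverse)
    (NormedRing.inverse_continuousAt (v t)) hu.continuousAt

/-! ### Generators and derivative families in terms of matrix entries -/

/-- `b` has the matrix entries of `δ_j(a)`; nothing is said about convergence in the norm. -/
def EntrywiseDeriv (j : Fin d) (a b : A) : Prop :=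
  ∀ k l, entry hA k l b = 2 * Real.pi * Complex.I * ((k - l) j : ℂ) * entry hA k l a

theorem isGenerator_iff_hasDerivAt (j : Fin d) (a b : A) :
    IsGenerator ι j a b ↔ HasDerivAt (fun h : ℝ => action hA (Pi.single j h) a) b 0 := by
  constructor
  · rintro ⟨ψ, hψ, hd⟩
    convert hd using 1
    funext h
    refine entry_ext hA fun k l => ?_
    rw [entry_action, (isModulationConj_iff hA _ _ _).1 (hψ h)]
  · intro h
    exact ⟨_, fun h => (isModulationConj_iff hA _ _ _).2 fun k l => entry_action hA _ _ _ _, h⟩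

theorem hasDerivAt_action {j : Fin d} {a b : A} (hab : IsGenerator ι j a b) (h : ℝ) :
    HasDerivAt (fun h : ℝ => action hA (Pi.single j h) a) (action hA (Pi.single j h) b) h := by
  rw [isGenerator_iff_hasDerivAt hA] at hab
  have h1 : HasDerivAt (fun s : ℝ => action hA (Pi.single j (s - h)) a) b h := by
    rw [← sub_self h] at hab
    exact hab.comp_sub_const h h
  have h2 := ((action hA (Pi.single j h)).restrictScalars ℝ).hasFDerivAt.comp_hasDerivAt h h1
  refine Eq.subst (motive := fun f => HasDerivAt f _ h) (funext fun s => ?_) h2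
  simp only [Function.comp_apply, ContinuousLinearMap.coe_restrictScalars']
  rw [← action_add, ← Pi.single_add, add_sub_cancel]

theorem hasDerivAt_phase_single (n : Fin d → ℤ) (j : Fin d) (h : ℝ) :
    HasDerivAt (fun h : ℝ => phase n (Pi.single j h))
      (phase n (Pi.single j h) * (2 * Real.pi * Complex.I * n j)) h := by
  simp_rw [phase_single]
  have h1 : HasDerivAt (fun h : ℝ => (h : ℂ) * (2 * Real.pi * Complex.I * n j))
      (1 * (2 * Real.pi * Complex.I * n j)) h := (Complex.ofRealCLM.hasDerivAt).mul_const _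
  simpa using h1.cexp

theorem IsGenerator.entrywiseDeriv {j : Fin d} {a b : A} (hab : IsGenerator ι j a b) :
    EntrywiseDeriv hA j a b := by
  intro k l
  rw [isGenerator_iff_hasDerivAt hA] at hab
  have h1 := ((entry hA k l).restrictScalars ℝ).hasFDerivAt.comp_hasDerivAt 0 hab
  have h2 := (hasDerivAt_phase_single (k - l) j 0).mul_const (entry hA k l a)
  have h3 : (⇑((entry hA k l).restrictScalars ℝ) ∘ fun h : ℝ => action hA (Pi.single j h) a) =
      fun h : ℝ => phase (k - l) (Pi.single j h) * entry hA k l a := by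
    funext h; simp [entry_action]
  rw [h3] at h1
  have h4 := h1.unique h2
  simpa [phase_zero_right] using h4

theorem IsGenerator.norm_action_sub_le {j : Fin d} {a b : A} (hab : IsGenerator ι j a b)
    (h : ℝ) : ‖action hA (Pi.single j h) a - a‖ ≤ |h| * (actionBound hA * ‖b‖) := by
  have := Convex.norm_image_sub_le_of_norm_hasDerivWithin_le (s := Set.univ) (x := 0) (y := h)
    (fun s _ => (hasDerivAt_action hA hab s).hasDerivWithinAt)
    (fun s _ => norm_action_le hA _ b) convex_univ trivial trivial
  simpa [action_zero, mul_comm] using this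

/-- The fundamental theorem of calculus, checked on matrix entries, recovers `a` from its
entrywise derivative. Norm-continuity of the orbit of `b` thus makes `a` differentiable in norm. -/
theorem EntrywiseDeriv.isGenerator [CompleteSpace A] {j : Fin d} {a b : A}
    (hab : EntrywiseDeriv hA j a b) (hb : b ∈ continuousVectors hA) : IsGenerator ι j a b := by
  have hc : Continuous fun h : ℝ => action hA (Pi.single j h) b :=
    ((mem_continuousVectors hA).1 hb).comp (continuous_single (A := fun _ => ℝ) j)
  have key : ∀ h : ℝ, action hA (Pi.single j h) a =
      a + ∫ s in (0 : ℝ)..h, action hA (Pi.single j s) b := by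
    intro h
    refine entry_ext hA fun k l => ?_
    have h0 := (entry hA k l).intervalIntegral_comp_comm
      (hc.intervalIntegrable (μ := MeasureTheory.volume) 0 h)
    rw [map_add, ← h0]
    have h1 : ∀ s ∈ Set.uIcc (0 : ℝ) h, HasDerivAt
        (fun s : ℝ => phase (k - l) (Pi.single j s) * entry hA k l a)
        (entry hA k l (action hA (Pi.single j s) b)) s := by
      intro s _
      rw [entry_action, hab k l]
      exact ((hasDerivAt_phase_single (k - l) j s).mul_const (entry hA k l a)).congr_deriv (by ring)
    rw [intervalIntegral.integral_eq_sub_of_hasDerivAt h1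
      (((entry hA k l).continuous.comp hc).intervalIntegrable 0 h), entry_action]
    simp [phase_zero_right]
  rw [isGenerator_iff_hasDerivAt hA]
  simp_rw [key]
  have := (intervalIntegral.integral_hasDerivAt_right (a := 0) (b := 0)
    (hc.intervalIntegrable (μ := MeasureTheory.volume) 0 0)
    (hc.stronglyMeasurableAtFilter _ _) hc.continuousAt).const_add a
  simpa [action_zero] using this

/-- Lipschitz bounds along the coordinate directions combine to one for the whole group. -/
theorem norm_action_sub_le_sum {a : A} {c : Fin d → ℝ}
    (h : ∀ j (s : ℝ), ‖action hA (Pi.single j s) a - a‖ ≤ |s| * c j) (t : Fin d → ℝ) :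
    ‖action hA t a - a‖ ≤ actionBound hA * ∑ j, |t j| * c j := by
  have key : ∀ s : Finset (Fin d), ‖action hA (∑ j ∈ s, Pi.single j (t j)) a - a‖ ≤
      actionBound hA * ∑ j ∈ s, |t j| * c j := by
    intro s
    induction s using Finset.induction_on with
    | empty => simp [action_zero]
    | insert j s hj ih =>
      rw [Finset.sum_insert hj, Finset.sum_insert hj, add_comm (Pi.single j (t j) : Fin d → ℝ),
        action_add, mul_add]
      set u : Fin d → ℝ := ∑ j ∈ s, Pi.single j (t j)
      have : action hA u (action hA (Pi.single j (t j)) a) - a =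
          action hA u (action hA (Pi.single j (t j)) a - a) + (action hA u a - a) := by
        rw [map_sub]; abel
      rw [this]
      refine (norm_add_le _ _).trans (add_le_add ((norm_action_le hA _ _).trans ?_) ih)
      exact mul_le_mul_of_nonneg_left (h j _) (actionBound_pos hA).le
  have := key Finset.univ
  rwa [Finset.univ_sum_single] at this

theorem mem_continuousVectors_of_isGenerator {a : A} {b : Fin d → A}
    (hab : ∀ j, IsGenerator ι j a (b j)) : a ∈ continuousVectors hA := by
  rw [mem_continuousVectors]
  set c : Fin d → ℝ := fun j => actionBound hA * ‖b j‖
  have hl : ∀ t, ‖action hA t a - a‖ ≤ actionBound hA * ∑ j, |t j| * c j :=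
    norm_action_sub_le_sum hA fun j s => IsGenerator.norm_action_sub_le hA (hab j) s
  rw [continuous_iff_continuousAt]
  intro t
  rw [ContinuousAt, tendsto_iff_norm_sub_tendsto_zero]
  have hle : ∀ s, ‖action hA s a - action hA t a‖ ≤
      actionBound hA * (actionBound hA * ∑ j, |(s - t) j| * c j) := by
    intro s
    have : action hA s a - action hA t a = action hA t (action hA (s - t) a - a) := by
      rw [map_sub, ← action_add, add_sub_cancel]
    rw [this]
    exact (norm_action_le hA _ _).trans
      (mul_le_mul_of_nonneg_left (hl _) (actionBound_pos hA).le)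
  refine squeeze_zero (fun _ => norm_nonneg _) hle ?_
  have hcont : Continuous fun s : Fin d → ℝ =>
      actionBound hA * (actionBound hA * ∑ j, |(s - t) j| * c j) := by
    simp only [Pi.sub_apply]; fun_prop
  have := hcont.tendsto t
  simpa using this

/-- The symbol `∏ⱼ (2πi nⱼ)^{αⱼ}` by which `δ^α` multiplies the `n`-th diagonal. -/
noncomputable def symbol (n : Fin d → ℤ) (α : Fin d → ℕ) : ℂ :=
  ∏ j, (2 * Real.pi * Complex.I * (n j : ℂ)) ^ α j

theorem symbol_zero (n : Fin d → ℤ) : symbol n 0 = 1 := by simp [symbol]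

theorem symbol_add_single (n : Fin d → ℤ) (α : Fin d → ℕ) (j : Fin d) :
    symbol n (α + Pi.single j 1) = 2 * Real.pi * Complex.I * (n j : ℂ) * symbol n α := by
  simp only [symbol, Pi.add_apply, pow_add, Finset.prod_mul_distrib]
  rw [mul_comm]
  congr 1
  rw [Finset.prod_eq_single j]
  · simp
  · intro i _ hi; simp [hi]
  · simp

theorem symbol_single (n : Fin d → ℤ) (j : Fin d) (i : ℕ) :
    symbol n (Pi.single j i) = (2 * Real.pi * Complex.I * (n j : ℂ)) ^ i := by
  rw [symbol, Finset.prod_eq_single j]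
  · simp
  · intro i _ hi; simp [hi]
  · simp

theorem norm_symbol (n : Fin d → ℤ) (α : Fin d → ℕ) :
    ‖symbol n α‖ = ∏ j, (2 * Real.pi * |(n j : ℝ)|) ^ α j := by
  simp [symbol, abs_of_pos Real.pi_pos]

theorem sum_add_single (α : Fin d → ℕ) (j : Fin d) :
    ∑ i, (α + Pi.single j 1 : Fin d → ℕ) i = ∑ i, α i + 1 := by
  simp [Finset.sum_add_distrib]

theorem eq_zero_of_sum_eq_zero {α : Fin d → ℕ} (h : ∑ j, α j = 0) : α = 0 :=
  funext fun j => Finset.sum_eq_zero_iff.1 h j (Finset.mem_univ j)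

theorem exists_ne_zero_of_sum_pos {α : Fin d → ℕ} (h : 0 < ∑ j, α j) : ∃ j, α j ≠ 0 := by
  by_contra! h'
  rw [Finset.sum_eq_zero fun j _ => h' j] at h
  exact h.false

theorem exists_eq_add_single {α : Fin d → ℕ} {k : ℕ} (h : ∑ j, α j = k + 1) :
    ∃ (β : Fin d → ℕ) (j : Fin d), α = β + Pi.single j 1 ∧ ∑ i, β i = k := by
  obtain ⟨j, hj⟩ := exists_ne_zero_of_sum_pos (h ▸ k.succ_pos : 0 < ∑ j, α j)
  have e : α = (α - Pi.single j 1) + Pi.single j 1 := by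
    funext i
    by_cases h : i = j
    · subst h; simp; omega
    · simp [h]
  refine ⟨_, j, e, ?_⟩
  rw [e, sum_add_single] at h
  omega

/-- Every multi-index arises from `0` by raising single coordinates. -/
theorem multiIndex_induction {p : (Fin d → ℕ) → Prop} (h0 : p 0)
    (h1 : ∀ α j, p α → p (α + Pi.single j 1)) (α : Fin d → ℕ) : p α := by
  obtain ⟨k, hk⟩ : ∃ k, ∑ j, α j = k := ⟨_, rfl⟩
  induction k generalizing α with
  | zero => rwa [eq_zero_of_sum_eq_zero hk]
  | succ k ih =>
    obtain ⟨β, j, rfl, hβ⟩ := exists_eq_add_single hk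
    exact h1 _ _ (ih _ hβ)

theorem symbol_zero_left {α : Fin d → ℕ} (h : 0 < ∑ j, α j) : symbol 0 α = 0 := by
  obtain ⟨j, hj⟩ := exists_ne_zero_of_sum_pos h
  rw [symbol, Finset.prod_eq_zero (Finset.mem_univ j)]
  simp [hj]

/-- A multi-index sequence is a derivative family as soon as it has the right matrix entries and
consists of vectors with norm-continuous orbits. -/
theorem isDerivativeFamily_iff [CompleteSpace A] (a : A) (D : (Fin d → ℕ) → A) :
    IsDerivativeFamily ι a D ↔
      (∀ α, D α ∈ continuousVectors hA) ∧
        ∀ α k l, entry hA k l (D α) = symbol (k - l) α * entry hA k l a := by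
  constructor
  · rintro ⟨h0, h⟩
    refine ⟨fun α => mem_continuousVectors_of_isGenerator hA fun j => h α j, fun α k l => ?_⟩
    induction α using multiIndex_induction with
    | h0 => rw [h0, symbol_zero, one_mul]
    | h1 α j ih =>
      rw [IsGenerator.entrywiseDeriv hA (h α j) k l, symbol_add_single, ih]; ring
  · rintro ⟨hc, he⟩
    refine ⟨entry_ext hA fun k l => by rw [he, symbol_zero, one_mul], fun α j => ?_⟩
    refine EntrywiseDeriv.isGenerator hA (fun k l => ?_) (hc _)
    rw [he, he, symbol_add_single]; ring

/-! ### Smooth elements and their inverses -/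

theorem EntrywiseDeriv.mul {j : Fin d} {a b a' b' : A} (ha : EntrywiseDeriv hA j a a')
    (hb : EntrywiseDeriv hA j b b') : EntrywiseDeriv hA j (a * b) (a' * b + a * b') := by
  intro k l
  rw [map_add]
  refine ((hasSum_entry_mul hA a' b k l).add (hasSum_entry_mul hA a b' k l)).unique ?_
  refine Eq.subst (motive := fun f => HasSum f _) (funext fun i => ?_)
    ((hasSum_entry_mul hA a b k l).mul_left (2 * Real.pi * Complex.I * ((k - l) j : ℂ)))
  rw [ha, hb]
  simp only [Pi.sub_apply]
  push_cast
  ring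

theorem IsGenerator.inv (hA : IsHomogeneousMatrixAlgebra ι) [CompleteSpace A] {j : Fin d}
    {u : Aˣ} {a' : A}
    (h : IsGenerator ι j (u : A) a') :
    IsGenerator ι j ((u⁻¹ : Aˣ) : A) (-((u⁻¹ : Aˣ) * a' * (u⁻¹ : Aˣ))) := by
  rw [isGenerator_iff_hasDerivAt hA] at *
  have hv : ∀ t, action hA t ((u⁻¹ : Aˣ) : A) = Ring.inverse (action hA t u) := fun t =>
    (Ring.inverse_unit ⟨action hA t u, action hA t (u⁻¹ : Aˣ),
      by rw [← action_mul, u.mul_inv, action_one],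
      by rw [← action_mul, u.inv_mul, action_one]⟩).symm
  simp_rw [hv]
  have h1 : HasFDerivAt (Ring.inverse : A → A)
      (-(ContinuousLinearMap.mulLeftRight ℝ A ((u⁻¹ : Aˣ) : A) ((u⁻¹ : Aˣ) : A)))
      (action hA (Pi.single j (0 : ℝ)) u) := by
    simpa [action_zero] using hasFDerivAt_ringInverse (𝕜 := ℝ) u
  have h2 := h1.comp_hasDerivAt 0 h
  refine h2.congr_deriv ?_
  simp

/-- `a` has entrywise derivatives of all orders up to `k` in the algebra, all with norm-continuous
orbits. -/
def HasDerivs : ℕ → A → Prop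
  | 0, a => a ∈ continuousVectors hA
  | k + 1, a => a ∈ continuousVectors hA ∧ ∀ j, ∃ b, EntrywiseDeriv hA j a b ∧ HasDerivs k b

theorem HasDerivs.mem {k : ℕ} {a : A} (h : HasDerivs hA k a) : a ∈ continuousVectors hA := by
  cases k with
  | zero => exact h
  | succ k => exact h.1

theorem HasDerivs.of_succ {k : ℕ} {a : A} (h : HasDerivs hA (k + 1) a) : HasDerivs hA k a := by
  induction k generalizing a with
  | zero => exact h.1
  | succ k ih =>
    refine ⟨h.1, fun j => ?_⟩
    obtain ⟨b, hb, hk⟩ := h.2 j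
    exact ⟨b, hb, ih hk⟩

theorem HasDerivs.add {k : ℕ} {a b : A} (ha : HasDerivs hA k a) (hb : HasDerivs hA k b) :
    HasDerivs hA k (a + b) := by
  induction k generalizing a b with
  | zero => exact (continuousVectors hA).add_mem ha hb
  | succ k ih =>
    refine ⟨(continuousVectors hA).add_mem ha.1 hb.1, fun j => ?_⟩
    obtain ⟨a', ha', hka⟩ := ha.2 j
    obtain ⟨b', hb', hkb⟩ := hb.2 j
    refine ⟨a' + b', fun k l => ?_, ih hka hkb⟩
    rw [map_add, map_add, ha', hb', mul_add]

theorem HasDerivs.neg {k : ℕ} {a : A} (ha : HasDerivs hA k a) : HasDerivs hA k (-a) := by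
  induction k generalizing a with
  | zero => exact (continuousVectors hA).neg_mem ha
  | succ k ih =>
    refine ⟨(continuousVectors hA).neg_mem ha.1, fun j => ?_⟩
    obtain ⟨a', ha', hka⟩ := ha.2 j
    refine ⟨-a', fun k l => ?_, ih hka⟩
    rw [map_neg, map_neg, ha', mul_neg]

theorem HasDerivs.mul {k : ℕ} {a b : A} (ha : HasDerivs hA k a) (hb : HasDerivs hA k b) :
    HasDerivs hA k (a * b) := by
  induction k generalizing a b with
  | zero => exact mul_mem_continuousVectors hA ha hb
  | succ k ih =>
    refine ⟨mul_mem_continuousVectors hA ha.1 hb.1, fun j => ?_⟩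
    obtain ⟨a', ha', hka⟩ := ha.2 j
    obtain ⟨b', hb', hkb⟩ := hb.2 j
    exact ⟨a' * b + a * b', ha'.mul hA hb',
      (ih hka (HasDerivs.of_succ hA hb)).add hA (ih (HasDerivs.of_succ hA ha) hkb)⟩

theorem HasDerivs.inv [CompleteSpace A] {k : ℕ} {u : Aˣ} (hu : HasDerivs hA k (u : A)) :
    HasDerivs hA k ((u⁻¹ : Aˣ) : A) := by
  induction k with
  | zero => exact inv_mem_continuousVectors hA u hu
  | succ k ih =>
    refine ⟨inv_mem_continuousVectors hA u hu.1, fun j => ?_⟩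
    obtain ⟨a', ha', hka⟩ := hu.2 j
    have hinv := ih (HasDerivs.of_succ hA hu)
    have hg := IsGenerator.inv hA (ha'.isGenerator hA (HasDerivs.mem hA hka))
    exact ⟨_, IsGenerator.entrywiseDeriv hA hg,
      HasDerivs.neg hA ((hinv.mul hA hka).mul hA hinv)⟩

theorem IsDerivativeFamily.hasDerivs [CompleteSpace A] {a : A} {D : (Fin d → ℕ) → A}
    (h : IsDerivativeFamily ι a D) (k : ℕ) (α : Fin d → ℕ) : HasDerivs hA k (D α) := by
  have hc := ((isDerivativeFamily_iff hA a D).1 h).1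
  induction k generalizing α with
  | zero => exact hc α
  | succ k ih =>
    exact ⟨hc α, fun j => ⟨_, IsGenerator.entrywiseDeriv hA (h.2 α j), ih _⟩⟩

theorem exists_isDerivativeFamily [CompleteSpace A] {a : A} (h : ∀ k, HasDerivs hA k a) :
    ∃ D, IsDerivativeFamily ι a D := by
  have key : ∀ α : Fin d → ℕ, ∀ a : A, HasDerivs hA (∑ j, α j) a →
      ∃ c ∈ continuousVectors hA, ∀ k l, entry hA k l c = symbol (k - l) α * entry hA k l a := by
    intro α
    induction α using multiIndex_induction with
    | h0 => exact fun a ha => ⟨a, HasDerivs.mem hA ha, fun k l => by rw [symbol_zero, one_mul]⟩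
    | h1 α j ih =>
      intro a ha
      rw [sum_add_single] at ha
      obtain ⟨b, hb, hbk⟩ := ha.2 j
      obtain ⟨c, hc, hce⟩ := ih b hbk
      refine ⟨c, hc, fun k l => ?_⟩
      rw [hce, hb, symbol_add_single]; ring
  choose D hD using fun α => key α a (h _)
  exact ⟨D, (isDerivativeFamily_iff hA a D).2 ⟨fun α => (hD α).1, fun α => (hD α).2⟩⟩

/-! ### Leibniz estimates -/

/-- A family of elements with the matrix entries of the derivatives of its `0`-th member. -/
def EntrywiseFamily (D : (Fin d → ℕ) → A) : Prop :=
  ∀ α k l, entry hA k l (D α) = symbol (k - l) α * entry hA k l (D 0)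

theorem IsDerivativeFamily.entrywiseFamily [CompleteSpace A] {a : A} {D : (Fin d → ℕ) → A}
    (h : IsDerivativeFamily ι a D) : EntrywiseFamily hA D := fun α k l => by
  rw [h.1]; exact ((isDerivativeFamily_iff hA a D).1 h).2 α k l

theorem EntrywiseFamily.deriv {D : (Fin d → ℕ) → A} (hD : EntrywiseFamily hA D) (α : Fin d → ℕ)
    (j : Fin d) : EntrywiseDeriv hA j (D α) (D (α + Pi.single j 1)) := fun k l => by
  rw [hD, hD α, symbol_add_single]; ring

theorem EntrywiseFamily.shift {D : (Fin d → ℕ) → A} (hD : EntrywiseFamily hA D) (j : Fin d) :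
    EntrywiseFamily hA fun α => D (α + Pi.single j 1) := fun α k l => by
  rw [hD.deriv, hD.deriv, hD]; ring

/-- The right-hand side of the Leibniz rule of order `k`. -/
def leibnizSum (a b : ℕ → ℝ) (k : ℕ) : ℝ :=
  ∑ p ∈ Finset.HasAntidiagonal.antidiagonal k, (k.choose p.1 : ℝ) * (a p.1 * b p.2)

theorem leibnizSum_succ (a b : ℕ → ℝ) (k : ℕ) :
    leibnizSum a b (k + 1) =
      leibnizSum (fun i => a (i + 1)) b k + leibnizSum a (fun i => b (i + 1)) k := by
  simp only [leibnizSum]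
  rw [Finset.sum_antidiagonal_choose_succ_mul (fun i j => a i * b j) k, add_comm]
  congr 1
  refine Finset.sum_congr rfl fun p hp => ?_
  rw [Nat.choose_symm_of_eq_add (Finset.HasAntidiagonal.mem_antidiagonal.1 hp).symm]

/-- The Leibniz estimate for `δ^α` of a product. It is proved by moving one derivative at a time from
`δ^α` onto the two factors, so that binomial coefficients of multi-indices never occur. -/
theorem exists_deriv_mul {D E : (Fin d → ℕ) → A} (hD : EntrywiseFamily hA D)
    (hE : EntrywiseFamily hA E) {a b : ℕ → ℝ} (ha : ∀ α, ‖D α‖ ≤ a (∑ j, α j))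
    (hb : ∀ α, ‖E α‖ ≤ b (∑ j, α j)) (α : Fin d → ℕ) :
    ∃ c, (∀ k l, entry hA k l c = symbol (k - l) α * entry hA k l (D 0 * E 0)) ∧
      ‖c‖ ≤ leibnizSum a b (∑ j, α j) := by
  induction α using multiIndex_induction generalizing D E a b with
  | h0 =>
    refine ⟨D 0 * E 0, fun k l => by rw [symbol_zero, one_mul], (norm_mul_le _ _).trans ?_⟩
    have h1 := ha 0
    have h2 := hb 0
    simp only [Pi.zero_apply, Finset.sum_const_zero] at h1 h2
    simpa [leibnizSum] using
      mul_le_mul h1 h2 (norm_nonneg _) ((norm_nonneg _).trans h1)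
  | h1 α j ih =>
    obtain ⟨c₁, h₁, n₁⟩ := ih (hD.shift hA j) hE (a := fun i => a (i + 1)) (b := b)
      (fun β => by have := ha (β + Pi.single j 1); rwa [sum_add_single] at this) hb
    obtain ⟨c₂, h₂, n₂⟩ := ih hD (hE.shift hA j) (a := a) (b := fun i => b (i + 1)) ha
      (fun β => by have := hb (β + Pi.single j 1); rwa [sum_add_single] at this)
    refine ⟨c₁ + c₂, fun k l => ?_, ?_⟩
    · rw [map_add, h₁, h₂, ← mul_add, ← map_add, ((hD.deriv hA 0 j).mul hA (hE.deriv hA 0 j)) k l,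
        symbol_add_single]
      ring
    · rw [sum_add_single, leibnizSum_succ]
      exact (norm_add_le _ _).trans (add_le_add n₁ n₂)

/-- The Leibniz rule without its top-order term `a · δ^α(b)`. -/
theorem exists_deriv_mul_sub {D E : (Fin d → ℕ) → A} (hD : EntrywiseFamily hA D)
    (hE : EntrywiseFamily hA E) {a b : ℕ → ℝ} (ha : ∀ α, ‖D α‖ ≤ a (∑ j, α j))
    (hb : ∀ α, ‖E α‖ ≤ b (∑ j, α j)) (α : Fin d → ℕ) :
    ∃ c, (∀ k l, entry hA k l c = symbol (k - l) α * entry hA k l (D 0 * E 0)) ∧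
      ‖c - D 0 * E α‖ ≤ leibnizSum a b (∑ j, α j) - a 0 * b (∑ j, α j) := by
  induction α using multiIndex_induction generalizing D E a b with
  | h0 => exact ⟨D 0 * E 0, fun k l => by rw [symbol_zero, one_mul], by simp [leibnizSum]⟩
  | h1 α j ih =>
    obtain ⟨c₁, h₁, n₁⟩ := exists_deriv_mul hA (hD.shift hA j) hE (a := fun i => a (i + 1)) (b := b)
      (fun β => by have := ha (β + Pi.single j 1); rwa [sum_add_single] at this) hb α
    obtain ⟨c₂, h₂, n₂⟩ := ih hD (hE.shift hA j) (a := a) (b := fun i => b (i + 1)) ha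
      (fun β => by have := hb (β + Pi.single j 1); rwa [sum_add_single] at this)
    refine ⟨c₁ + c₂, fun k l => ?_, ?_⟩
    · rw [map_add, h₁, h₂, ← mul_add, ← map_add, ((hD.deriv hA 0 j).mul hA (hE.deriv hA 0 j)) k l,
        symbol_add_single]
      ring
    · rw [sum_add_single, leibnizSum_succ, add_sub_assoc, add_sub_assoc]
      exact (norm_add_le _ _).trans (add_le_add n₁ n₂)

/-- The recursion for the derivatives of an inverse has a geometric majorant. -/
theorem le_of_inverse_recursion {a e : ℕ → ℝ} {K C ρ : ℝ} (n : ℕ) (hK : 0 ≤ K) (hC : 0 ≤ C)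
    (hρ : 0 ≤ ρ) (he : ∀ i, 0 ≤ e i) (he0 : e 0 ≤ K)
    (ha : ∀ i, 1 ≤ i → i ≤ n → a i ≤ C * i.factorial * ρ ^ i)
    (hrec : ∀ i, 1 ≤ i → e i ≤ K * (leibnizSum a e i - a 0 * e i)) :
    ∀ k ≤ n, e k ≤ K * (1 + K * C) ^ k * ρ ^ k * k.factorial := by
  intro k
  induction k using Nat.strong_induction_on with
  | _ k ih =>
    intro hk
    rcases k with _ | k
    · simpa using he0
    refine (hrec (k + 1) (by omega)).trans ?_
    rw [mul_assoc, mul_assoc]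
    refine mul_le_mul_of_nonneg_left ?_ hK
    set q := 1 + K * C with hq
    have hq0 : 0 ≤ q := by positivity
    have h1 : leibnizSum a e (k + 1) - a 0 * e (k + 1) = ∑ p ∈ Finset.HasAntidiagonal.antidiagonal k,
        ((k + 1).choose (p.1 + 1) : ℝ) * (a (p.1 + 1) * e p.2) := by
      rw [leibnizSum, Finset.Nat.sum_antidiagonal_succ]; simp
    rw [h1]
    have h2 : ∀ p ∈ Finset.HasAntidiagonal.antidiagonal k,
        ((k + 1).choose (p.1 + 1) : ℝ) * (a (p.1 + 1) * e p.2) ≤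
          (K * C * q ^ p.2) * (ρ ^ (k + 1) * (k + 1).factorial) := by
      intro p hp
      have hp' : p.1 + p.2 = k := Finset.HasAntidiagonal.mem_antidiagonal.1 hp
      have e1 := ha (p.1 + 1) (by omega) (by omega)
      have e2 := ih p.2 (by omega) (by omega)
      have hf : ((k + 1).choose (p.1 + 1) : ℝ) * (p.1 + 1).factorial * p.2.factorial =
          (k + 1).factorial := by
        have := Nat.choose_mul_factorial_mul_factorial (show p.1 + 1 ≤ k + 1 by omega)
        rw [show k + 1 - (p.1 + 1) = p.2 by omega] at this
        exact_mod_cast this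
      have hρ' : ρ ^ (k + 1) = ρ ^ (p.1 + 1) * ρ ^ p.2 := by
        rw [← pow_add]; congr 1; omega
      calc ((k + 1).choose (p.1 + 1) : ℝ) * (a (p.1 + 1) * e p.2)
          ≤ ((k + 1).choose (p.1 + 1) : ℝ) * ((C * (p.1 + 1).factorial * ρ ^ (p.1 + 1)) *
              (K * q ^ p.2 * ρ ^ p.2 * p.2.factorial)) := by
            refine mul_le_mul_of_nonneg_left ?_ (by positivity)
            exact mul_le_mul e1 e2 (he _) (by positivity)
        _ = _ := by rw [hρ', ← hf]; ring
    refine (Finset.sum_le_sum h2).trans ?_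
    rw [← Finset.sum_mul, ← Finset.mul_sum]
    have h3 : ∑ p ∈ Finset.HasAntidiagonal.antidiagonal k, q ^ p.2 = ∑ i ∈ Finset.range (k + 1), q ^ i := by
      rw [Finset.Nat.sum_antidiagonal_eq_sum_range_succ_mk,
        ← Finset.sum_range_reflect (fun i => q ^ i)]
      refine Finset.sum_congr rfl fun i _ => ?_
      simp
    have h4 : K * C * ∑ i ∈ Finset.range (k + 1), q ^ i = q ^ (k + 1) - 1 := by
      have := mul_geom_sum q (k + 1)
      rw [← this, hq]; ring
    rw [h3, h4]
    refine mul_le_mul_of_nonneg_right (by linarith) (by positivity)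

/-- The largest norm of a member of order `i` of a family indexed by multi-indices. -/
noncomputable def orderSup {B : Type*} [SeminormedAddCommGroup B] (D : (Fin d → ℕ) → B) (i : ℕ) : ℝ :=
  (((Finset.piAntidiag Finset.univ i).sup fun α => ‖D α‖₊ : NNReal) : ℝ)

theorem norm_le_orderSup {B : Type*} [SeminormedAddCommGroup B] (D : (Fin d → ℕ) → B) (α : Fin d → ℕ) :
    ‖D α‖ ≤ orderSup D (∑ j, α j) := by
  have : α ∈ Finset.piAntidiag Finset.univ (∑ j, α j) := by simp [Finset.mem_piAntidiag]
  exact_mod_cast Finset.le_sup (f := fun α => ‖D α‖₊) this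

theorem orderSup_nonneg {B : Type*} [SeminormedAddCommGroup B] (D : (Fin d → ℕ) → B) (i : ℕ) : 0 ≤ orderSup D i := NNReal.coe_nonneg _

theorem orderSup_le {B : Type*} [SeminormedAddCommGroup B] {D : (Fin d → ℕ) → B} {i : ℕ} {x : ℝ} (hx : 0 ≤ x)
    (h : ∀ α, ∑ j, α j = i → ‖D α‖ ≤ x) : orderSup D i ≤ x := by
  lift x to NNReal using hx
  refine NNReal.coe_le_coe.2 (Finset.sup_le fun α hα => ?_)
  exact_mod_cast h α (Finset.mem_piAntidiag.1 hα).1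

theorem orderSup_inv_recursion (hA : IsHomogeneousMatrixAlgebra ι) [CompleteSpace A] {u : Aˣ} {D E : (Fin d → ℕ) → A}
    (hD : IsDerivativeFamily ι (u : A) D) (hE : IsDerivativeFamily ι ((u⁻¹ : Aˣ) : A) E)
    (i : ℕ) (hi : 1 ≤ i) :
    orderSup E i ≤ ‖((u⁻¹ : Aˣ) : A)‖ *
      (leibnizSum (orderSup D) (orderSup E) i - orderSup D 0 * orderSup E i) := by
  have key : ∀ α : Fin d → ℕ, ∑ j, α j = i → ‖E α‖ ≤ ‖((u⁻¹ : Aˣ) : A)‖ *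
      (leibnizSum (orderSup D) (orderSup E) i - orderSup D 0 * orderSup E i) := by
    rintro α rfl
    obtain ⟨c, hc, hn⟩ := exists_deriv_mul_sub hA (IsDerivativeFamily.entrywiseFamily hA hD)
      (IsDerivativeFamily.entrywiseFamily hA hE) (norm_le_orderSup D) (norm_le_orderSup E) α
    rw [hD.1, hE.1, u.mul_inv] at hc
    have hc0 : c = 0 := by
      refine entry_ext hA fun k l => ?_
      rw [hc, entry_one, map_zero]
      split_ifs with h
      · rw [h, sub_self, symbol_zero_left hi, zero_mul]
      · rw [mul_zero]
    rw [hc0, zero_sub, norm_neg, hD.1] at hn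
    calc ‖E α‖ = ‖((u⁻¹ : Aˣ) : A) * (u * E α)‖ := by rw [Units.inv_mul_cancel_left]
      _ ≤ ‖((u⁻¹ : Aˣ) : A)‖ * ‖(u : A) * E α‖ := norm_mul_le _ _
      _ ≤ _ := mul_le_mul_of_nonneg_left hn (norm_nonneg _)
  by_cases hne : ∃ α : Fin d → ℕ, ∑ j, α j = i
  · obtain ⟨α, hα⟩ := hne
    exact orderSup_le ((norm_nonneg _).trans (key α hα)) key
  · -- without multi-indices of order `i` (that is, for `d = 0`) all suprema of that order are `0`
    have hz : ∀ F : (Fin d → ℕ) → A, orderSup F i = 0 := fun F =>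
      le_antisymm (orderSup_le le_rfl fun α hα => (hne ⟨α, hα⟩).elim) (orderSup_nonneg F i)
    rw [hz E, mul_zero, sub_zero]
    exact mul_nonneg (norm_nonneg _) (Finset.sum_nonneg fun p _ => mul_nonneg (by positivity)
      (mul_nonneg (orderSup_nonneg _ _) (orderSup_nonneg _ _)))

/-! ### Sufficiency of almost increase -/

theorem mem_carlemanClass_iff {M : ℕ → ℝ} (hM : ∀ k, 0 < M k) (a : A) :
    a ∈ carlemanClass ι M ↔ ∃ r > 0, ∃ C ≥ 0, ∃ D, IsDerivativeFamily ι a D ∧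
      ∀ α, ‖D α‖ ≤ C * (r ^ (∑ j, α j) * M (∑ j, α j)) := by
  simp only [carlemanClass, carlemanSpace, Set.mem_iUnion, Set.mem_Ioi, Set.mem_ofPred_eq,
    exists_prop]
  constructor
  · rintro ⟨r, hr, D, hD, C, hC⟩
    refine ⟨r, hr, C, ?_, D, hD, fun α => ?_⟩
    · exact le_trans (by have := hM (∑ j, (0 : Fin d → ℕ) j); positivity) (hC 0)
    · have := hM (∑ j, α j)
      exact (div_le_iff₀ (by positivity)).1 (hC α)
  · rintro ⟨r, hr, C, -, D, hD, hC⟩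
    refine ⟨r, hr, D, hD, C, fun α => ?_⟩
    have := hM (∑ j, α j)
    exact (div_le_iff₀ (by positivity)).2 (hC α)

/-- Log-convexity of `M` is not needed: the bound at order `n` only uses the comparison of the roots of
orders `i ≤ n` with the one of order `n`. -/
theorem isInverseClosed_of_isAlmostIncreasing (hA : IsHomogeneousMatrixAlgebra ι) [CompleteSpace A]
    {M : ℕ → ℝ} (hM : IsDefiningSequence M) (hinc : IsAlmostIncreasing (rootSeq M)) :
    IsInverseClosed (carlemanClass ι M) := by
  intro u hu
  rw [mem_carlemanClass_iff hM.2] at hu ⊢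
  obtain ⟨r, hr, C, hC, D, hD, hDC⟩ := hu
  obtain ⟨c, hc, hinc⟩ := hinc
  obtain ⟨E, hE⟩ := exists_isDerivativeFamily hA (a := ((u⁻¹ : Aˣ) : A)) fun k =>
    HasDerivs.inv hA (by simpa [hD.1] using IsDerivativeFamily.hasDerivs hA hD k 0)
  set K := ‖((u⁻¹ : Aˣ) : A)‖ with hK
  set s := max c 1
  have hs : 0 < s := one_pos.trans_le (le_max_right _ _)
  have hE0 : orderSup E 0 ≤ K := orderSup_le (norm_nonneg _) fun α hα => by
    rw [eq_zero_of_sum_eq_zero hα, hE.1]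
  refine ⟨(1 + K * C) * (r * s), by positivity, K, norm_nonneg _, E, hE, fun α => ?_⟩
  obtain ⟨n, hn⟩ : ∃ n, ∑ j, α j = n := ⟨_, rfl⟩
  refine (norm_le_orderSup E α).trans ?_
  rw [hn]
  have hu := rootSeq_nonneg (hM.2 n).le
  have key := le_of_inverse_recursion (a := orderSup D) (e := orderSup E) (K := K) (C := C)
    (ρ := r * s * rootSeq M n) n (norm_nonneg _) hC (by positivity) (orderSup_nonneg E) hE0
    (fun i hi hin => ?_) (orderSup_inv_recursion hA hD hE) n le_rfl
  · rcases Nat.eq_zero_or_pos n with h0 | h0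
    · subst h0
      simpa [hM.1] using key
    · refine key.trans_eq ?_
      rw [rootSeq_pow M (hM.2 n).le h0, mul_pow, mul_pow (1 + K * C)]
      ring
  · have h1 : orderSup D i ≤ C * (r ^ i * M i) := by
      have := hM.2 i
      exact orderSup_le (by positivity) fun β hβ => by simpa [hβ] using hDC β
    have h2 : rootSeq M i ≤ s * rootSeq M n := by
      rcases hin.eq_or_lt with h | h
      · rw [h]; exact le_mul_of_one_le_left hu (le_max_right _ _)
      · exact (hinc i n hi h).trans (mul_le_mul_of_nonneg_right (le_max_left _ _) hu)
    have h3 := pow_le_pow_left₀ (rootSeq_nonneg (hM.2 i).le) h2 i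
    calc orderSup D i ≤ C * (r ^ i * M i) := h1
      _ = C * i.factorial * r ^ i * rootSeq M i ^ i := by
        rw [rootSeq_pow M (hM.2 i).le hi]; ring
      _ ≤ C * i.factorial * r ^ i * (s * rootSeq M n) ^ i :=
        mul_le_mul_of_nonneg_left h3 (by positivity)
      _ = _ := by rw [mul_assoc r, mul_pow r]; ring

/-! ### The degenerate case -/

/-- If the regularization vanishes beyond index `0`, the Carleman class consists of diagonal
matrices only: an off-diagonal entry would give a geometric minorant of the weight. -/
theorem entry_eq_zero_of_logConvexReg_eq_zero (hA : IsHomogeneousMatrixAlgebra ι)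
    [CompleteSpace A] {M : ℕ → ℝ} (hM : IsDefiningSequence M) (h1 : logConvexReg M 1 = 0) {a : A}
    (ha : a ∈ carlemanClass ι M) {k l : Fin d → ℤ} (hkl : k ≠ l) : entry hA k l a = 0 := by
  obtain ⟨r, hr, C, hC, D, hD, hDC⟩ := (mem_carlemanClass_iff hM.2 a).1 ha
  obtain ⟨j, hj⟩ := Function.ne_iff.1 hkl
  by_contra hne
  set q : ℝ := 2 * Real.pi * |((k - l) j : ℝ)|
  have hq : 0 < q := by
    have : ((k - l) j : ℝ) ≠ 0 := by
      simpa [sub_eq_zero] using hj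
    positivity
  set B := ‖entry hA k l‖
  have hle : ∀ n, q ^ n * ‖entry hA k l a‖ ≤ (B + 1) * (C + 1) * (r ^ n * M n) := by
    intro n
    have e := ((isDerivativeFamily_iff hA a D).1 hD).2 (Pi.single j n) k l
    have e2 := congrArg norm e
    rw [norm_mul, symbol_single, norm_pow] at e2
    have e3 : ‖2 * Real.pi * Complex.I * ((k - l) j : ℂ)‖ = q := by
      rw [norm_mul, Complex.norm_intCast]
      simp [q, abs_of_pos Real.pi_pos]
    rw [e3] at e2
    rw [← e2]
    refine ((entry hA k l).le_opNorm _).trans ?_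
    have h3 := hDC (Pi.single j n)
    have hM' := hM.2 n
    have hsum : ∑ i, (Pi.single j n : Fin d → ℕ) i = n := by simp
    rw [hsum] at h3
    rw [mul_assoc]
    refine mul_le_mul (by simp [B]) (h3.trans ?_) (norm_nonneg _) (by positivity)
    exact mul_le_mul_of_nonneg_right (by simp) (by positivity)
  set c : ℝ := ‖entry hA k l a‖ / ((B + 1) * (C + 1)) with hc
  have hB : 0 ≤ B := norm_nonneg _
  have hcpos : 0 < c := div_pos (norm_pos_iff.2 hne) (by positivity)
  have h2 := geometric_le_logConvexReg (M := M) (c := c) (q := q / r) hcpos.le (by positivity)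
    (fun n => by
      rw [hc, div_pow, div_mul_div_comm, div_le_iff₀ (by positivity)]
      linarith [hle n]) 1
  rw [h1, pow_one] at h2
  exact absurd h2 (not_le.2 (by positivity))

theorem isInverseClosed_of_logConvexReg_eq_zero (hA : IsHomogeneousMatrixAlgebra ι)
    [CompleteSpace A] {M : ℕ → ℝ} (hM : IsDefiningSequence M) (h1 : logConvexReg M 1 = 0) :
    IsInverseClosed (carlemanClass ι M) := by
  intro u hu
  have hfix : ∀ t, action hA t (u : A) = u := fun t => entry_ext hA fun k l => by
    rw [entry_action]
    by_cases h : k = l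
    · rw [h, sub_self, phase_zero_left, one_mul]
    · rw [entry_eq_zero_of_logConvexReg_eq_zero hA hM h1 hu h, mul_zero]
  have hfix' : ∀ t, action hA t ((u⁻¹ : Aˣ) : A) = (u⁻¹ : Aˣ) := fun t => by
    refine Units.eq_inv_of_mul_eq_one_left (u := u) ?_
    calc (u : A) * action hA t ((u⁻¹ : Aˣ) : A)
        = action hA t ((u : A) * (u⁻¹ : Aˣ)) := by rw [action_mul, hfix]
      _ = 1 := by rw [u.mul_inv, action_one]
  classical
  rw [mem_carlemanClass_iff hM.2]
  refine ⟨1, one_pos, ‖((u⁻¹ : Aˣ) : A)‖, norm_nonneg _,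
    fun α => if α = 0 then ((u⁻¹ : Aˣ) : A) else 0, ⟨by simp, fun α j => ?_⟩, fun α => ?_⟩
  · have hne : α + Pi.single j 1 ≠ 0 := fun h => by simpa using congrFun h j
    dsimp only
    rw [if_neg hne, isGenerator_iff_hasDerivAt hA]
    split_ifs
    · simp_rw [hfix']; exact hasDerivAt_const _ _
    · simp_rw [map_zero]; exact hasDerivAt_const _ _
  · have := hM.2 (∑ j, α j)
    dsimp only
    split_ifs with h
    · subst h; simp [hM.1]
    · rw [norm_zero]; positivity

/-! ### Fourier multipliers -/

/-- An integer vector as a point of Euclidean space. -/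
noncomputable def intVec (n : Fin d → ℤ) : EuclideanSpace ℝ (Fin d) :=
  WithLp.toLp 2 fun j => (n j : ℝ)

/-- The operator multiplying the `n`-th diagonal by `φ(s n)`, realised as an average of the
modulations `χ_t` against the inverse Fourier transform of `φ`. -/
noncomputable def multiplier (φ : SchwartzMap (EuclideanSpace ℝ (Fin d)) ℂ) (s : ℝ) (y : A) : A :=
  ∫ t : EuclideanSpace ℝ (Fin d), (𝓕⁻ φ) t • action hA (-(s • WithLp.ofLp t)) y

/-- An upper bound, independent of the scale `s`, for the norm of `multiplier hA φ s`. -/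
noncomputable def multiplierBound (φ : SchwartzMap (EuclideanSpace ℝ (Fin d)) ℂ) : ℝ :=
  (∫ t : EuclideanSpace ℝ (Fin d), ‖(𝓕⁻ φ) t‖) * actionBound hA

theorem multiplierBound_nonneg (φ : SchwartzMap (EuclideanSpace ℝ (Fin d)) ℂ) :
    0 ≤ multiplierBound hA φ :=
  mul_nonneg (MeasureTheory.integral_nonneg fun _ => norm_nonneg _) (actionBound_pos hA).le

theorem norm_multiplier_le (φ : SchwartzMap (EuclideanSpace ℝ (Fin d)) ℂ) (s : ℝ) (y : A) :
    ‖multiplier hA φ s y‖ ≤ multiplierBound hA φ * ‖y‖ := by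
  rw [multiplierBound, mul_assoc, ← MeasureTheory.integral_mul_const]
  refine MeasureTheory.norm_integral_le_of_norm_le ((𝓕⁻ φ).integrable.norm.mul_const _)
    (Filter.Eventually.of_forall fun t => ?_)
  rw [norm_smul]
  exact mul_le_mul_of_nonneg_left (norm_action_le hA _ _) (norm_nonneg _)

theorem continuous_action_scaled {y : A} (hy : y ∈ continuousVectors hA) (s : ℝ) :
    Continuous fun t : EuclideanSpace ℝ (Fin d) => action hA (-(s • WithLp.ofLp t)) y := by
  have h : Continuous fun t : EuclideanSpace ℝ (Fin d) => -(s • WithLp.ofLp t) := by fun_prop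
  exact ((mem_continuousVectors hA).1 hy).comp h

theorem integrable_multiplier (φ : SchwartzMap (EuclideanSpace ℝ (Fin d)) ℂ) (s : ℝ) {y : A}
    (hy : y ∈ continuousVectors hA) : MeasureTheory.Integrable
      fun t : EuclideanSpace ℝ (Fin d) => (𝓕⁻ φ) t • action hA (-(s • WithLp.ofLp t)) y := by
  refine ((𝓕⁻ φ).integrable.norm.mul_const (actionBound hA * ‖y‖)).mono'
    (((𝓕⁻ φ).continuous.smul (continuous_action_scaled hA hy s)).aestronglyMeasurable)
    (Filter.Eventually.of_forall fun t => ?_)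
  rw [norm_smul]
  exact mul_le_mul_of_nonneg_left (norm_action_le hA _ _) (norm_nonneg _)

/-- Fourier inversion for Schwartz functions, evaluated at the frequencies that occur in matrices. -/
theorem integral_mul_phase (φ : SchwartzMap (EuclideanSpace ℝ (Fin d)) ℂ) (s : ℝ)
    (n : Fin d → ℤ) : ∫ t : EuclideanSpace ℝ (Fin d),
      (𝓕⁻ φ) t * phase n (-(s • WithLp.ofLp t)) = φ (s • intVec n) := by
  have h : (𝓕 (𝓕⁻ φ : SchwartzMap (EuclideanSpace ℝ (Fin d)) ℂ)) (s • intVec n) =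
      φ (s • intVec n) := by rw [FourierTransform.fourier_fourierInv_eq]
  rw [← h, SchwartzMap.fourier_coe, Real.fourier_eq']
  refine MeasureTheory.integral_congr_ae (Filter.Eventually.of_forall fun t => ?_)
  dsimp only
  rw [smul_eq_mul, mul_comm, phase]
  congr 2
  rw [PiLp.inner_apply]
  simp only [intVec, PiLp.smul_apply, RCLike.inner_apply, conj_trivial, Pi.neg_apply,
    Pi.smul_apply, smul_eq_mul]
  push_cast
  simp only [Finset.mul_sum, Finset.sum_mul]
  refine Finset.sum_congr rfl fun j _ => ?_
  ring

theorem entry_multiplier [CompleteSpace A] (φ : SchwartzMap (EuclideanSpace ℝ (Fin d)) ℂ) (s : ℝ)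
    {y : A} (hy : y ∈ continuousVectors hA) (k l : Fin d → ℤ) :
    entry hA k l (multiplier hA φ s y) = φ (s • intVec (k - l)) * entry hA k l y := by
  rw [multiplier, ← (entry hA k l).integral_comp_comm (integrable_multiplier hA φ s hy),
    ← integral_mul_phase, ← MeasureTheory.integral_mul_const]
  refine MeasureTheory.integral_congr_ae (Filter.Eventually.of_forall fun t => ?_)
  dsimp only
  rw [map_smul, entry_action, smul_eq_mul, mul_assoc]

theorem multiplier_mem_continuousVectors [CompleteSpace A]
    (φ : SchwartzMap (EuclideanSpace ℝ (Fin d)) ℂ) (s : ℝ) {y : A}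
    (hy : y ∈ continuousVectors hA) : multiplier hA φ s y ∈ continuousVectors hA := by
  rw [mem_continuousVectors, continuous_iff_continuousAt]
  intro t
  have hc := ((mem_continuousVectors hA).1 hy).continuousAt (x := t)
  rw [ContinuousAt, tendsto_iff_norm_sub_tendsto_zero] at hc ⊢
  have hle : ∀ u, ‖action hA u (multiplier hA φ s y) - action hA t (multiplier hA φ s y)‖ ≤
      multiplierBound hA φ * ‖action hA u y - action hA t y‖ := by
    intro u
    have hu := action_mem_continuousVectors hA u hy
    have ht := action_mem_continuousVectors hA t hy
    have : action hA u (multiplier hA φ s y) - action hA t (multiplier hA φ s y) =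
        multiplier hA φ s (action hA u y - action hA t y) := by
      refine entry_ext hA fun k l => ?_
      rw [entry_multiplier hA φ s ((continuousVectors hA).sub_mem hu ht)]
      simp only [map_sub, entry_action, entry_multiplier hA φ s hy]
      ring
    rw [this]
    exact norm_multiplier_le hA _ _ _
  refine squeeze_zero (fun _ => norm_nonneg _) hle ?_
  simpa using hc.const_mul (multiplierBound hA φ)

/-! ### A smooth low-pass filter and the inequalities of Bernstein and Favard -/

/-- A smooth bump function, `1` on the unit ball and `0` outside the ball of radius `2`. -/
noncomputable def bump (d : ℕ) : ContDiffBump (0 : EuclideanSpace ℝ (Fin d)) :=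
  ⟨1, 2, one_pos, one_lt_two⟩

/-- The bump function as a complex-valued Schwartz function. -/
noncomputable def lowPass (d : ℕ) : SchwartzMap (EuclideanSpace ℝ (Fin d)) ℂ :=
  HasCompactSupport.toSchwartzMap (f := fun x => ((bump d x : ℝ) : ℂ))
    ((bump d).hasCompactSupport.comp_left Complex.ofReal_zero)
    (Complex.ofRealCLM.contDiff.comp (bump d).contDiff)

/-- The function `2πi xⱼ`, cut off smoothly outside the ball of radius `2`. -/
noncomputable def lowPassDeriv (d : ℕ) (j : Fin d) : SchwartzMap (EuclideanSpace ℝ (Fin d)) ℂ :=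
  HasCompactSupport.toSchwartzMap
    (f := fun x => (2 * Real.pi * Complex.I * (x j : ℂ)) * ((bump d ((1 / 2 : ℝ) • x) : ℝ) : ℂ))
    (HasCompactSupport.mul_left (((bump d).hasCompactSupport.comp_smul (by norm_num)).comp_left
      Complex.ofReal_zero))
    (ContDiff.mul (contDiff_const.mul (Complex.ofRealCLM.contDiff.comp (by fun_prop)))
      (Complex.ofRealCLM.contDiff.comp ((bump d).contDiff.comp (contDiff_const_smul _))))

theorem lowPass_apply (x : EuclideanSpace ℝ (Fin d)) : lowPass d x = ((bump d x : ℝ) : ℂ) := rfl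

theorem lowPass_eq_one {x : EuclideanSpace ℝ (Fin d)} (h : ‖x‖ ≤ 1) : lowPass d x = 1 := by
  rw [lowPass_apply, (bump d).one_of_mem_closedBall (by simpa [bump] using h), Complex.ofReal_one]

theorem lowPass_eq_zero {x : EuclideanSpace ℝ (Fin d)} (h : 2 ≤ ‖x‖) : lowPass d x = 0 := by
  rw [lowPass_apply, (bump d).zero_of_le_dist (by simpa [bump] using h), Complex.ofReal_zero]

theorem lowPassDeriv_apply {x : EuclideanSpace ℝ (Fin d)} (h : ‖x‖ ≤ 2) (j : Fin d) :
    lowPassDeriv d j x = 2 * Real.pi * Complex.I * (x j : ℂ) := by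
  have : lowPassDeriv d j x =
    (2 * Real.pi * Complex.I * (x j : ℂ)) * ((bump d ((1 / 2 : ℝ) • x) : ℝ) : ℂ) := rfl
  rw [this, (bump d).one_of_mem_closedBall, Complex.ofReal_one, mul_one]
  simp [bump, norm_smul]
  linarith

theorem norm_intVec_ge_one {n : Fin d → ℤ} (h : n ≠ 0) : 1 ≤ ‖intVec n‖ := by
  obtain ⟨j, hj⟩ := Function.ne_iff.1 h
  have h1 : ‖(intVec n) j‖ ≤ ‖intVec n‖ := PiLp.norm_apply_le _ _
  refine le_trans ?_ h1
  have : (1 : ℝ) ≤ |((n j : ℤ) : ℝ)| := by exact_mod_cast Int.one_le_abs hj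
  simpa [intVec] using this

/-- Bernstein's inequality: on elements with spectrum in the ball of radius `2N` the derivations
are bounded by a multiple of `N`. -/
theorem norm_le_of_lowFrequency [CompleteSpace A] {j : Fin d} {p q : A} {N : ℝ} (hN : 0 < N)
    (hp : p ∈ continuousVectors hA)
    (hlow : ∀ k l, 2 ≤ ‖N⁻¹ • intVec (k - l)‖ → entry hA k l p = 0)
    (hpq : EntrywiseDeriv hA j p q) :
    ‖q‖ ≤ N * (multiplierBound hA (lowPassDeriv d j) * ‖p‖) := by
  have : q = (N : ℂ) • multiplier hA (lowPassDeriv d j) N⁻¹ p := by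
    refine entry_ext hA fun k l => ?_
    rw [hpq, map_smul, entry_multiplier hA _ _ hp, smul_eq_mul]
    rcases le_total 2 ‖N⁻¹ • intVec (k - l)‖ with h | h
    · rw [hlow k l h]; ring
    · rw [lowPassDeriv_apply h]
      have hN' : (N : ℂ) ≠ 0 := by exact_mod_cast hN.ne'
      simp only [intVec, PiLp.smul_apply, smul_eq_mul]
      push_cast
      field_simp
  rw [this, norm_smul, Complex.norm_real, Real.norm_of_nonneg hN.le]
  exact mul_le_mul_of_nonneg_left (norm_multiplier_le hA _ _ _) hN.le

/-- The constant in `norm_le_of_highFrequency`. -/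
noncomputable def highPassBound : ℝ :=
  (∫ t : EuclideanSpace ℝ (Fin d), ‖t‖ * ‖(𝓕⁻ (lowPass d)) t‖) * (2 * actionBound hA ^ 2)

/-- Favard's inequality: elements without spectrum in the ball of radius `N` are controlled by
`1/N` times their derivatives, because the low-pass filter at scale `N/2` annihilates them while it
differs from the identity by an average of small modulations. -/
theorem norm_le_of_highFrequency [CompleteSpace A] {y : A} {z : Fin d → A} {N : ℝ} (hN : 0 < N)
    (hhigh : ∀ k l, ‖N⁻¹ • intVec (k - l)‖ < 1 → entry hA k l y = 0)
    (hyz : ∀ j, IsGenerator ι j y (z j)) :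
    ‖y‖ ≤ highPassBound hA / N * ∑ j, ‖z j‖ := by
  have hy := mem_continuousVectors_of_isGenerator hA hyz
  have hzero : multiplier hA (lowPass d) (2 * N⁻¹) y = 0 := by
    refine entry_ext hA fun k l => ?_
    rw [entry_multiplier hA _ _ hy, map_zero]
    rcases lt_or_ge ‖N⁻¹ • intVec (k - l)‖ 1 with h | h
    · rw [hhigh k l h, mul_zero]
    · rw [lowPass_eq_zero, zero_mul]
      rw [mul_smul, norm_smul]
      norm_num
      linarith
  have hint : ∫ t, (𝓕⁻ (lowPass d)) t = 1 := by
    have := integral_mul_phase (lowPass d) 0 (0 : Fin d → ℤ)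
    simp only [phase_zero_left, mul_one, zero_smul] at this
    rw [this, lowPass_eq_one (by simp)]
  have hrep : y = ∫ t : EuclideanSpace ℝ (Fin d), (𝓕⁻ (lowPass d)) t •
      (y - action hA (-((2 * N⁻¹) • WithLp.ofLp t)) y) := by
    simp_rw [smul_sub]
    rw [MeasureTheory.integral_sub ((𝓕⁻ (lowPass d)).integrable.smul_const y)
      (integrable_multiplier hA _ _ hy), integral_smul_const, hint, one_smul]
    change y = y - multiplier hA (lowPass d) (2 * N⁻¹) y
    rw [hzero, sub_zero]
  have hbound : highPassBound hA / N * ∑ j, ‖z j‖ =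
      ∫ t : EuclideanSpace ℝ (Fin d), (‖t‖ * ‖(𝓕⁻ (lowPass d)) t‖) *
        (2 * actionBound hA ^ 2 * N⁻¹ * ∑ j, ‖z j‖) := by
    rw [MeasureTheory.integral_mul_const, highPassBound]; ring
  rw [hbound]
  conv_lhs => rw [hrep]
  have hi : MeasureTheory.Integrable fun t : EuclideanSpace ℝ (Fin d) =>
      ‖t‖ * ‖(𝓕⁻ (lowPass d)) t‖ := by
    have h := (𝓕⁻ (lowPass d)).integrable_pow_mul MeasureTheory.volume 1
    simp only [pow_one] at h
    exact h
  refine MeasureTheory.norm_integral_le_of_norm_le (hi.mul_const _)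
    (Filter.Eventually.of_forall fun t => ?_)
  rw [norm_smul, mul_comm ‖t‖, mul_assoc]
  refine mul_le_mul_of_nonneg_left ?_ (norm_nonneg _)
  rw [norm_sub_rev]
  refine (norm_action_sub_le_sum hA (fun j s => IsGenerator.norm_action_sub_le hA (hyz j) s)
    _).trans ?_
  have hsum : ∑ j, |(-((2 * N⁻¹) • WithLp.ofLp t)) j| * (actionBound hA * ‖z j‖) ≤
      ∑ j, (2 * N⁻¹ * ‖t‖) * (actionBound hA * ‖z j‖) := by
    refine Finset.sum_le_sum fun j _ => mul_le_mul_of_nonneg_right ?_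
      (mul_nonneg (actionBound_pos hA).le (norm_nonneg _))
    have h1 : |t j| ≤ ‖t‖ := PiLp.norm_apply_le t j
    have h2 : 0 ≤ 2 * N⁻¹ := by positivity
    simp only [Pi.neg_apply, Pi.smul_apply, smul_eq_mul, abs_neg]
    rw [abs_mul, abs_of_nonneg h2]
    exact mul_le_mul_of_nonneg_left h1 h2
  refine (mul_le_mul_of_nonneg_left hsum (actionBound_pos hA).le).trans_eq ?_
  rw [← Finset.mul_sum, ← Finset.mul_sum]
  ring

/-! ### The Carleman class depends only on the regularized sequence -/

/-- The low-frequency part at scale `N` of the members of a derivative family. -/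
noncomputable def lowPart (D : (Fin d → ℕ) → A) (N : ℝ) (α : Fin d → ℕ) : A :=
  multiplier hA (lowPass d) N⁻¹ (D α)

/-- The constant with which the frequency estimates for `lowPart` and its complement hold. -/
noncomputable def frequencyBound : ℝ :=
  1 + multiplierBound hA (lowPass d) + ∑ j, multiplierBound hA (lowPassDeriv d j) +
    d * highPassBound hA

theorem highPassBound_nonneg : 0 ≤ highPassBound hA :=
  mul_nonneg (MeasureTheory.integral_nonneg fun _ => mul_nonneg (norm_nonneg _) (norm_nonneg _))
    (by positivity)

theorem frequencyBound_bounds : 1 ≤ frequencyBound hA ∧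
    1 + multiplierBound hA (lowPass d) ≤ frequencyBound hA ∧
    (∀ j, multiplierBound hA (lowPassDeriv d j) ≤ frequencyBound hA) ∧
    d * highPassBound hA ≤ frequencyBound hA := by
  have h1 := multiplierBound_nonneg hA (lowPass d)
  have h2 : ∀ j ∈ Finset.univ, 0 ≤ multiplierBound hA (lowPassDeriv d j) :=
    fun j _ => multiplierBound_nonneg hA _
  have h3 := Finset.sum_nonneg h2
  have h4 : 0 ≤ d * highPassBound hA := mul_nonneg (by positivity) (highPassBound_nonneg hA)
  refine ⟨?_, ?_, fun j => ?_, ?_⟩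
  · unfold frequencyBound; linarith
  · unfold frequencyBound; linarith
  · have := Finset.single_le_sum h2 (Finset.mem_univ j)
    unfold frequencyBound; linarith
  · unfold frequencyBound; linarith

section

variable [CompleteSpace A] {a : A} {D : (Fin d → ℕ) → A}

theorem entry_lowPart (hD : IsDerivativeFamily ι a D) (N : ℝ) (α : Fin d → ℕ) (k l : Fin d → ℤ) :
    entry hA k l (lowPart hA D N α) = lowPass d (N⁻¹ • intVec (k - l)) * entry hA k l (D α) :=
  entry_multiplier hA _ _ (((isDerivativeFamily_iff hA a D).1 hD).1 α) k l

theorem lowPart_mem (hD : IsDerivativeFamily ι a D) (N : ℝ) (α : Fin d → ℕ) : lowPart hA D N α ∈ continuousVectors hA :=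
  multiplier_mem_continuousVectors hA _ _ (((isDerivativeFamily_iff hA a D).1 hD).1 α)

theorem entrywiseDeriv_lowPart (hD : IsDerivativeFamily ι a D) (N : ℝ) (α : Fin d → ℕ) (j : Fin d) :
    EntrywiseDeriv hA j (lowPart hA D N α) (lowPart hA D N (α + Pi.single j 1)) := fun k l => by
  rw [entry_lowPart hA hD, entry_lowPart hA hD, IsGenerator.entrywiseDeriv hA (hD.2 α j) k l]
  ring

theorem norm_lowPart_le (hD : IsDerivativeFamily ι a D) {N : ℝ} (hN : 0 < N)
    {m : ℕ} {Y : ℝ}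
    (hY : ∀ β : Fin d → ℕ, ∑ j, β j = m → ‖D β‖ ≤ Y) (i : ℕ) {α : Fin d → ℕ}
    (hα : ∑ j, α j = m + i) :
    ‖lowPart hA D N α‖ ≤ frequencyBound hA * (frequencyBound hA * N) ^ i * Y := by
  obtain ⟨hc1, hc2, hc3, -⟩ := frequencyBound_bounds hA
  induction i generalizing α with
  | zero =>
    rw [pow_zero, mul_one]
    refine (norm_multiplier_le hA _ _ _).trans ?_
    exact mul_le_mul (by linarith) (hY α hα) (norm_nonneg _) (by linarith)
  | succ i ih =>
    obtain ⟨β, j, rfl, hβ⟩ := exists_eq_add_single (k := m + i) hα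
    have h := norm_le_of_lowFrequency hA hN (lowPart_mem hA hD N β) (fun k l hkl => by
      rw [entry_lowPart hA hD, lowPass_eq_zero hkl, zero_mul]) (entrywiseDeriv_lowPart hA hD N β j)
    have h2 := mul_le_mul (hc3 j) (ih hβ) (norm_nonneg _) (by linarith)
    refine (h.trans (mul_le_mul_of_nonneg_left h2 hN.le)).trans_eq ?_
    rw [pow_succ]; ring

theorem norm_sub_lowPart_le (hD : IsDerivativeFamily ι a D) {N : ℝ} (hN : 0 < N)
    {k : ℕ} (i : ℕ) {Y : ℝ} (hY0 : 0 ≤ Y)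
    (hY : ∀ β : Fin d → ℕ, ∑ j, β j = k + i → ‖D β‖ ≤ Y) {α : Fin d → ℕ} (hα : ∑ j, α j = k) :
    ‖D α - lowPart hA D N α‖ ≤ frequencyBound hA * (frequencyBound hA / N) ^ i * Y := by
  obtain ⟨hc1, hc2, -, hc4⟩ := frequencyBound_bounds hA
  have hc0 : 0 ≤ frequencyBound hA := by linarith
  induction i generalizing α k with
  | zero =>
    rw [pow_zero, mul_one]
    have h1 := norm_multiplier_le hA (lowPass d) N⁻¹ (D α)
    calc ‖D α - lowPart hA D N α‖ ≤ ‖D α‖ + multiplierBound hA (lowPass d) * ‖D α‖ :=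
          (norm_sub_le _ _).trans (add_le_add le_rfl h1)
      _ = (1 + multiplierBound hA (lowPass d)) * ‖D α‖ := by ring
      _ ≤ _ := mul_le_mul hc2 (hY α hα) (norm_nonneg _) hc0
  | succ i ih =>
    have hc := (isDerivativeFamily_iff hA a D).1 hD
    have hgen : ∀ j, IsGenerator ι j (D α - lowPart hA D N α)
        (D (α + Pi.single j 1) - lowPart hA D N (α + Pi.single j 1)) := fun j => by
      refine EntrywiseDeriv.isGenerator hA (fun k l => ?_)
        ((continuousVectors hA).sub_mem (hc.1 _) (lowPart_mem hA hD N _))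
      rw [map_sub, map_sub, IsGenerator.entrywiseDeriv hA (hD.2 α j) k l,
        entrywiseDeriv_lowPart hA hD N α j k l]
      ring
    have h := norm_le_of_highFrequency hA hN (fun k l hkl => by
      rw [map_sub, entry_lowPart hA hD, lowPass_eq_one hkl.le]; ring) hgen
    have hterm : ∀ j ∈ Finset.univ, ‖D (α + Pi.single j 1) - lowPart hA D N (α + Pi.single j 1)‖ ≤
        frequencyBound hA * (frequencyBound hA / N) ^ i * Y := fun j _ =>
      ih (k := k + 1) (fun β hβ => hY β (by omega)) (by rw [sum_add_single, hα])
    have hs := Finset.sum_le_sum hterm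
    rw [Finset.sum_const, Finset.card_univ, Fintype.card_fin, nsmul_eq_mul] at hs
    have hg := highPassBound_nonneg hA
    refine (h.trans (mul_le_mul_of_nonneg_left hs (by positivity))).trans ?_
    have : highPassBound hA / N * (d * (frequencyBound hA * (frequencyBound hA / N) ^ i * Y)) =
        (d * highPassBound hA) * (frequencyBound hA * (frequencyBound hA / N) ^ i * Y / N) := by
      ring
    rw [this, pow_succ]
    refine (mul_le_mul_of_nonneg_right hc4 (by positivity)).trans_eq ?_
    ring

/-- At scale `1/2` only the main diagonal has low frequency, and derivations kill it. -/
theorem lowPart_half_eq_zero (hD : IsDerivativeFamily ι a D) {α : Fin d → ℕ}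
    (hα : 0 < ∑ j, α j) : lowPart hA D (1 / 2) α = 0 := by
  refine entry_ext hA fun k l => ?_
  rw [entry_lowPart hA hD, map_zero]
  by_cases h : k - l = 0
  · rw [((isDerivativeFamily_iff hA a D).1 hD).2 α k l, h, symbol_zero_left hα]
    ring
  · rw [lowPass_eq_zero, zero_mul]
    have := norm_intVec_ge_one h
    rw [norm_smul]
    norm_num
    linarith

/-- A Kolmogorov-type inequality. The scale `N` is chosen so that both the part of `D α` above `N`
and the part below `2N` carry half of its norm. The Favard inequality for the former bounds the
weights of order at least `|α|` below, the Bernstein inequality for the latter those of order at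
most `|α|`, and together they produce a geometric minorant of the weight. -/
theorem norm_le_logConvexReg (hD : IsDerivativeFamily ι a D) {M : ℕ → ℝ} (hM : ∀ k, 0 < M k)
    {r C : ℝ} (hr : 0 < r) (hC : 0 < C) (hDC : ∀ α, ‖D α‖ ≤ C * (r ^ (∑ j, α j) * M (∑ j, α j)))
    {α : Fin d → ℕ} (hα : 0 < ∑ j, α j) :
    ‖D α‖ ≤ 2 * frequencyBound hA * C *
      ((2 * frequencyBound hA ^ 2 * r) ^ (∑ j, α j) * logConvexReg M (∑ j, α j)) := by
  obtain ⟨n, hn⟩ : ∃ n, ∑ j, α j = n := ⟨_, rfl⟩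
  rw [hn] at hα ⊢
  set c := frequencyBound hA
  have hc1 : 1 ≤ c := (frequencyBound_bounds hA).1
  have hc : 0 < c := by linarith
  set x := ‖D α‖ with hx
  rcases (norm_nonneg (D α)).eq_or_lt with h0 | h0
  · rw [hx, ← h0]
    have := logConvexReg_nonneg (M := M) n
    positivity
  have hY : ∀ m, 0 ≤ C * (r ^ m * M m) := fun m => by have := hM m; positivity
  have hbd : ∀ m (β : Fin d → ℕ), ∑ j, β j = m → ‖D β‖ ≤ C * (r ^ m * M m) := by
    rintro m β rfl; exact hDC β
  -- the part of high frequency tends to zero as the scale grows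
  have hex : ∃ i : ℕ, ‖D α - lowPart hA D (1 / 2 * 2 ^ i) α‖ < x / 2 := by
    obtain ⟨i, hi⟩ := pow_unbounded_of_one_lt (4 * (c * c * (C * (r ^ (n + 1) * M (n + 1)))) / x)
      (one_lt_two (α := ℝ))
    refine ⟨i, ?_⟩
    have h := norm_sub_lowPart_le hA hD (N := 1 / 2 * 2 ^ i) (by positivity) 1 (hY (n + 1))
      (hbd (n + 1)) hn
    refine h.trans_lt ?_
    rw [div_lt_iff₀ h0] at hi
    rw [pow_one, mul_assoc, mul_comm, div_mul_eq_mul_div, div_mul_eq_mul_div,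
      div_lt_iff₀ (by positivity)]
    change _ < x / 2 * (1 / 2 * 2 ^ i)
    nlinarith
  classical
  set i₀ := Nat.find hex with hi₀
  have hi₀s := Nat.find_spec hex
  have hne : i₀ ≠ 0 := by
    intro h
    rw [← hi₀, h, pow_zero, mul_one, lowPart_half_eq_zero hA hD (hn ▸ hα), sub_zero] at hi₀s
    linarith
  -- minimality of `i₀`: at the scale `N` just below, the part of high frequency is still large
  obtain ⟨i, hi⟩ := Nat.exists_eq_succ_of_ne_zero hne
  set N : ℝ := 1 / 2 * 2 ^ i with hN
  have hNpos : 0 < N := by positivity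
  have hhigh : x / 2 ≤ ‖D α - lowPart hA D N α‖ :=
    not_lt.1 (Nat.find_min hex (m := i) (by omega))
  have hlow : x / 2 ≤ ‖lowPart hA D (2 * N) α‖ := by
    have h2N : 1 / 2 * 2 ^ i₀ = 2 * N := by rw [hi, hN, Nat.succ_eq_add_one, pow_succ]; ring
    rw [← hi₀, h2N] at hi₀s
    have := norm_sub_norm_le (D α) (lowPart hA D (2 * N) α)
    linarith
  have hhigh' : ∀ i, x ≤ 2 * c * C * ((c / N) ^ i * (r ^ (n + i) * M (n + i))) := fun i => by
    have := hhigh.trans (norm_sub_lowPart_le hA hD hNpos i (hY (n + i)) (hbd (n + i)) hn)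
    have e : 2 * c * C * ((c / N) ^ i * (r ^ (n + i) * M (n + i))) =
        2 * (c * (c / N) ^ i * (C * (r ^ (n + i) * M (n + i)))) := by ring
    rw [e]; linarith
  have hlow' : ∀ m i, n = m + i → x ≤ 2 * c * C * ((2 * c * N) ^ i * (r ^ m * M m)) :=
    fun m i hmi => by
    have := hlow.trans (norm_lowPart_le hA hD (N := 2 * N) (by positivity) (hbd m) i
      (hn.trans hmi))
    have e : 2 * c * C * ((2 * c * N) ^ i * (r ^ m * M m)) =
        2 * (c * (c * (2 * N)) ^ i * (C * (r ^ m * M m))) := by ring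
    rw [e]; linarith
  have hN2 : N / c ≤ 2 * c * N := by
    rw [div_le_iff₀ hc]
    nlinarith [mul_le_mul hc1 hc1 zero_le_one hc.le]
  have hq1 : ∀ m, r ^ m * (N / (c * r)) ^ m = (N / c) ^ m := fun m => by
    rw [← mul_pow]; congr 1; field_simp
  have hq2 : ∀ m, (c / N) ^ m * (N / c) ^ m = 1 := fun m => by
    rw [← mul_pow, div_mul_div_cancel₀ hNpos.ne', div_self hc.ne', one_pow]
  have key : ∀ m, x * (N / (c * r)) ^ m ≤ 2 * c * C * (2 * c * N) ^ n * M m := by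
    intro m
    have hMm := hM m
    rcases le_total n m with h | h
    · obtain ⟨i, rfl⟩ := Nat.exists_eq_add_of_le h
      calc x * (N / (c * r)) ^ (n + i)
          ≤ 2 * c * C * ((c / N) ^ i * (r ^ (n + i) * M (n + i))) * (N / (c * r)) ^ (n + i) :=
            mul_le_mul_of_nonneg_right (hhigh' i) (by positivity)
        _ = 2 * c * C * (N / c) ^ n * M (n + i) := by
            calc _ = 2 * c * C * ((c / N) ^ i *
                  (r ^ (n + i) * (N / (c * r)) ^ (n + i))) * M (n + i) := by ring
              _ = 2 * c * C * ((c / N) ^ i * (N / c) ^ i * (N / c) ^ n) * M (n + i) := by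
                rw [hq1, pow_add]; ring
              _ = _ := by rw [hq2, one_mul]
        _ ≤ _ := by gcongr
    · obtain ⟨i, rfl⟩ := Nat.exists_eq_add_of_le h
      calc x * (N / (c * r)) ^ m
          ≤ 2 * c * C * ((2 * c * N) ^ i * (r ^ m * M m)) * (N / (c * r)) ^ m :=
            mul_le_mul_of_nonneg_right (hlow' m i rfl) (by positivity)
        _ = 2 * c * C * ((N / c) ^ m * (2 * c * N) ^ i) * M m := by
            rw [← hq1]; ring
        _ ≤ 2 * c * C * ((2 * c * N) ^ m * (2 * c * N) ^ i) * M m := by gcongr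
        _ = _ := by rw [pow_add]
  have hgeo := geometric_le_logConvexReg (M := M) (c := x / (2 * c * C * (2 * c * N) ^ n))
    (q := N / (c * r)) (by positivity) (by positivity) (fun m => by
      rw [div_mul_eq_mul_div, div_le_iff₀ (by positivity)]
      linarith [key m]) n
  rw [div_mul_eq_mul_div, div_le_iff₀ (by positivity)] at hgeo
  have hpos : 0 < (N / (c * r)) ^ n := by positivity
  refine le_of_mul_le_mul_right (hgeo.trans_eq ?_) hpos
  have e : (2 * c * N) ^ n = (2 * c ^ 2 * r) ^ n * (N / (c * r)) ^ n := by
    rw [← mul_pow]; congr 1; field_simp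
  rw [e]; ring

end

/-- The Kolmogorov-type inequality transfers the growth condition from `M` to its regularization, at
the price of a larger `r`. -/
theorem carlemanClass_logConvexReg (hA : IsHomogeneousMatrixAlgebra ι) [CompleteSpace A]
    {M : ℕ → ℝ} (hM : IsDefiningSequence M) (hpos : ∀ k, 0 < logConvexReg M k) :
    carlemanClass ι (logConvexReg M) = carlemanClass ι M := by
  ext a
  rw [mem_carlemanClass_iff hM.2, mem_carlemanClass_iff hpos]
  constructor
  · rintro ⟨r, hr, C, hC, D, hD, hDC⟩
    refine ⟨r, hr, C, hC, D, hD, fun α => (hDC α).trans ?_⟩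
    have := logConvexReg_le (fun k => (hM.2 k).le) (∑ j, α j)
    gcongr
  · rintro ⟨r, hr, C, hC, D, hD, hDC⟩
    have hc1 := (frequencyBound_bounds hA).1
    refine ⟨2 * frequencyBound hA ^ 2 * r, by positivity, 2 * frequencyBound hA * (C + 1),
      by positivity, D, hD, fun α => ?_⟩
    have hDC' : ∀ α, ‖D α‖ ≤ (C + 1) * (r ^ (∑ j, α j) * M (∑ j, α j)) := fun α => by
      have := hM.2 (∑ j, α j)
      refine (hDC α).trans ?_
      gcongr
      linarith
    rcases Nat.eq_zero_or_pos (∑ j, α j) with h | h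
    · refine (hDC' α).trans ?_
      rw [h, pow_zero, pow_zero, hM.1, logConvexReg_zero hM]
      nlinarith
    · exact norm_le_logConvexReg hA hD hM.2 hr (by positivity) hDC' h

/-! ### Series of translation operators -/

variable (hT : HasBoundedTranslations ι)

/-- The translation operator `T_v`, as an element of the algebra. -/
noncomputable def translation (v : Fin d → ℤ) : A := (hT.choose_spec v).choose

/-- A positive bound for the norms of all translation operators. -/
noncomputable def translationBound : ℝ := max hT.choose 1

theorem translationBound_pos : 0 < translationBound hT := one_pos.trans_le (le_max_right _ _)

theorem norm_translation_le (v : Fin d → ℤ) : ‖translation hT v‖ ≤ translationBound hT :=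
  (hT.choose_spec v).choose_spec.2.trans (le_max_left _ _)

theorem isTranslation_translation (v : Fin d → ℤ) : IsTranslation v (ι (translation hT v)) :=
  (hT.choose_spec v).choose_spec.1

theorem entry_translation (v k l : Fin d → ℤ) :
    entry hA k l (translation hT v) = if k - v = l then 1 else 0 := by
  rw [entry_eq, opEntry, isTranslation_translation hT v, lp.single_apply]
  by_cases h : k - v = l
  · subst h; simp
  · simp [h]

theorem translation_add (hA : IsHomogeneousMatrixAlgebra ι) (v w : Fin d → ℤ) :
    translation hT (v + w) = translation hT v * translation hT w := by
  refine entry_ext hA fun k l => ?_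
  rw [entry_translation, entry_eq, map_mul]
  have : opEntry (ι (translation hT v) * ι (translation hT w)) k l =
      (lp.single 2 l (1 : ℂ) : EllTwo d) (k - v - w) := by
    rw [← isTranslation_translation hT w, ← isTranslation_translation hT v]
    rfl
  rw [this, lp.single_apply, sub_sub]
  by_cases h : k - (v + w) = l
  · subst h; simp
  · simp [h]

theorem action_translation (t : Fin d → ℝ) (v : Fin d → ℤ) :
    action hA t (translation hT v) = phase v t • translation hT v := by
  refine entry_ext hA fun k l => ?_
  rw [entry_action, map_smul, entry_translation, smul_eq_mul]
  split_ifs with h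
  · rw [← h, sub_sub_cancel]
  · rw [mul_zero, mul_zero]

theorem continuous_phase (n : Fin d → ℤ) : Continuous (phase n) := by
  unfold phase
  fun_prop

theorem norm_phase (n : Fin d → ℤ) (t : Fin d → ℝ) : ‖phase n t‖ = 1 := by
  have : 2 * Real.pi * Complex.I * ∑ j, (n j : ℂ) * (t j : ℂ) =
      ((2 * Real.pi * ∑ j, (n j : ℝ) * t j : ℝ) : ℂ) * Complex.I := by
    push_cast; ring
  rw [phase, this, Complex.norm_exp_ofReal_mul_I]

/-- The frequency `n` in the direction `j`. -/
def freq (j : Fin d) (n : ℕ) : Fin d → ℤ := Pi.single j (n : ℤ)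

theorem norm_symbol_freq_le (j : Fin d) (n : ℕ) (α : Fin d → ℕ) :
    ‖symbol (freq j n) α‖ ≤ (2 * Real.pi * n) ^ (∑ i, α i) := by
  rw [norm_symbol, ← Finset.prod_pow_eq_pow_sum]
  refine Finset.prod_le_prod (fun i _ => by positivity) fun i _ => ?_
  refine pow_le_pow_left₀ (by positivity) ?_ _
  refine mul_le_mul_of_nonneg_left ?_ (by positivity)
  by_cases h : i = j
  · subst h; simp [freq]
  · simp [freq, h]

/-- The derivative of order `α` of the series `∑ₘ wₘ T_{νₘ eⱼ}` of translation operators. -/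
noncomputable def translationSeries (j : Fin d) (w : ℕ → ℝ) (ν : ℕ → ℕ) (α : Fin d → ℕ) : A :=
  ∑' m, ((w m : ℂ) * symbol (freq j (ν m)) α) • translation hT (freq j (ν m))

section Series

variable {j : Fin d} {w : ℕ → ℝ} {ν : ℕ → ℕ} {B : ℕ → ℝ}

theorem norm_translationSeries_term_le (hw : ∀ m, 0 < w m)
    (hB : ∀ m k, w m * (ν m : ℝ) ^ k ≤ (1 / 2) ^ m * B k) (α : Fin d → ℕ) (m : ℕ) :
    ‖((w m : ℂ) * symbol (freq j (ν m)) α) • translation hT (freq j (ν m))‖ ≤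
      (1 / 2) ^ m * ((2 * Real.pi) ^ (∑ i, α i) * B (∑ i, α i) * translationBound hT) := by
  have hwm := hw m
  rw [norm_smul, norm_mul, Complex.norm_real, Real.norm_of_nonneg hwm.le]
  have h1 := hB m (∑ i, α i)
  calc w m * ‖symbol (freq j (ν m)) α‖ * ‖translation hT (freq j (ν m))‖
      ≤ w m * (2 * Real.pi * ν m) ^ (∑ i, α i) * translationBound hT :=
        mul_le_mul (mul_le_mul_of_nonneg_left (norm_symbol_freq_le _ _ _) hwm.le)
          (norm_translation_le _ _) (norm_nonneg _) (by positivity)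
    _ = (w m * (ν m : ℝ) ^ (∑ i, α i)) * ((2 * Real.pi) ^ (∑ i, α i) * translationBound hT) := by
        rw [mul_pow]; ring
    _ ≤ ((1 / 2) ^ m * B (∑ i, α i)) * ((2 * Real.pi) ^ (∑ i, α i) * translationBound hT) :=
        mul_le_mul_of_nonneg_right h1
          (mul_nonneg (by positivity) (translationBound_pos hT).le)
    _ = _ := by ring

theorem summable_translationSeries [CompleteSpace A] (hw : ∀ m, 0 < w m)
    (hB : ∀ m k, w m * (ν m : ℝ) ^ k ≤ (1 / 2) ^ m * B k) (α : Fin d → ℕ) :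
    Summable fun m => ((w m : ℂ) * symbol (freq j (ν m)) α) • translation hT (freq j (ν m)) :=
  Summable.of_norm_bounded (summable_geometric_two.mul_right _)
    (norm_translationSeries_term_le hT hw hB α)

theorem norm_translationSeries_le (hw : ∀ m, 0 < w m)
    (hB : ∀ m k, w m * (ν m : ℝ) ^ k ≤ (1 / 2) ^ m * B k) (α : Fin d → ℕ) :
    ‖translationSeries hT j w ν α‖ ≤
      2 * ((2 * Real.pi) ^ (∑ i, α i) * B (∑ i, α i) * translationBound hT) :=
  tsum_of_norm_bounded (hasSum_geometric_two.mul_right _)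
    (norm_translationSeries_term_le hT hw hB α)

theorem hasSum_entry_translationSeries [CompleteSpace A] (hw : ∀ m, 0 < w m)
    (hB : ∀ m k, w m * (ν m : ℝ) ^ k ≤ (1 / 2) ^ m * B k) (α : Fin d → ℕ) (k l : Fin d → ℤ) :
    HasSum (fun m => (w m : ℂ) * symbol (freq j (ν m)) α *
      if k - freq j (ν m) = l then 1 else 0) (entry hA k l (translationSeries hT j w ν α)) := by
  refine Eq.subst (motive := fun f => HasSum f _) (funext fun m => ?_)
    ((summable_translationSeries hT (j := j) hw hB α).hasSum.mapL (entry hA k l))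
  simp only [map_smul, entry_translation, smul_eq_mul]

theorem entry_translationSeries [CompleteSpace A] (hw : ∀ m, 0 < w m)
    (hB : ∀ m k, w m * (ν m : ℝ) ^ k ≤ (1 / 2) ^ m * B k) (α : Fin d → ℕ) (k l : Fin d → ℤ) :
    entry hA k l (translationSeries hT j w ν α) =
      symbol (k - l) α * entry hA k l (translationSeries hT j w ν 0) := by
  refine (hasSum_entry_translationSeries hA hT hw hB α k l).unique ?_
  refine Eq.subst (motive := fun f => HasSum f _) (funext fun m => ?_)
    ((hasSum_entry_translationSeries hA hT hw hB 0 k l).mul_left (symbol (k - l) α))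
  rw [symbol_zero]
  split_ifs with h
  · rw [← h, sub_sub_cancel]; ring
  · ring

theorem translationSeries_mem [CompleteSpace A] (hw : ∀ m, 0 < w m)
    (hB : ∀ m k, w m * (ν m : ℝ) ^ k ≤ (1 / 2) ^ m * B k) (α : Fin d → ℕ) :
    translationSeries hT j w ν α ∈ continuousVectors hA := by
  rw [mem_continuousVectors]
  have : ∀ t, action hA t (translationSeries hT j w ν α) = ∑' m, phase (freq j (ν m)) t •
      (((w m : ℂ) * symbol (freq j (ν m)) α) • translation hT (freq j (ν m))) := fun t => by
    rw [translationSeries, (action hA t).map_tsum (summable_translationSeries hT hw hB α)]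
    refine tsum_congr fun m => ?_
    rw [map_smul, action_translation, smul_comm]
  simp_rw [this]
  refine continuous_tsum (fun m => (continuous_phase _).smul continuous_const)
    (summable_geometric_two.mul_right
      ((2 * Real.pi) ^ (∑ i, α i) * B (∑ i, α i) * translationBound hT)) fun m t => ?_
  rw [norm_smul, norm_phase, one_mul]
  exact norm_translationSeries_term_le hT hw hB α m

/-! ### Matrices with nonnegative entries -/

/-- All matrix entries of `a` are nonnegative real numbers. -/
def NonnegEntries (a : A) : Prop := ∀ k l, 0 ≤ entry hA k l a

theorem NonnegEntries.mul {a b : A} (ha : NonnegEntries hA a) (hb : NonnegEntries hA b) :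
    NonnegEntries hA (a * b) := fun k l =>
  (hasSum_entry_mul hA a b k l).nonneg fun i => mul_nonneg (ha k i) (hb i l)

theorem NonnegEntries.add {a b : A} (ha : NonnegEntries hA a) (hb : NonnegEntries hA b) :
    NonnegEntries hA (a + b) := fun k l => by
  rw [map_add]; exact add_nonneg (ha k l) (hb k l)

theorem NonnegEntries.smul {a : A} (ha : NonnegEntries hA a) {c : ℝ} (hc : 0 ≤ c) :
    NonnegEntries hA ((c : ℂ) • a) := fun k l => by
  rw [map_smul]; exact mul_nonneg (Complex.zero_le_real.2 hc) (ha k l)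

theorem nonnegEntries_one : NonnegEntries hA 1 := fun k l => by
  rw [entry_one]; split_ifs <;> simp

theorem NonnegEntries.pow {a : A} (ha : NonnegEntries hA a) (n : ℕ) :
    NonnegEntries hA (a ^ n) := by
  induction n with
  | zero => rw [pow_zero]; exact nonnegEntries_one hA
  | succ n ih => rw [pow_succ]; exact ih.mul hA ha

theorem nonnegEntries_translation (v : Fin d → ℤ) : NonnegEntries hA (translation hT v) :=
  fun k l => by rw [entry_translation]; split_ifs <;> simp

/-- Cancellation being impossible, the `p`-th power of a series dominates the `p`-th powers of its
terms. -/
theorem nonnegEntries_pow_sub {f g : A} {c : ℝ} {v : Fin d → ℤ} (hc : 0 ≤ c)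
    (hg : NonnegEntries hA g) (hf : f = (c : ℂ) • translation hT v + g) (p : ℕ) :
    NonnegEntries hA (f ^ p - ((c ^ p : ℝ) : ℂ) • translation hT (p • v)) := by
  have hτ := (nonnegEntries_translation hA hT v).smul hA hc
  have hf0 : NonnegEntries hA f := hf ▸ hτ.add hA hg
  induction p with
  | zero =>
    have : translation hT 0 = 1 := entry_ext hA fun k l => by
      rw [entry_translation, entry_one, sub_zero]
    intro k l
    simp [this]
  | succ p ih =>
    have : f ^ (p + 1) - ((c ^ (p + 1) : ℝ) : ℂ) • translation hT ((p + 1) • v) =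
        (f ^ p - ((c ^ p : ℝ) : ℂ) • translation hT (p • v)) * ((c : ℂ) • translation hT v) +
          f ^ p * g := by
      rw [sub_mul, smul_mul_smul_comm, ← translation_add hT hA, succ_nsmul, pow_succ, pow_succ]
      push_cast
      conv_lhs => rw [hf, mul_add, ← hf]
      abel
    rw [this]
    exact (ih.mul hA hτ).add hA ((hf0.pow hA p).mul hA hg)

theorem exists_norm_entry_le :
    ∃ L : ℝ, 0 < L ∧ ∀ (k l : Fin d → ℤ) (a : A), ‖entry hA k l a‖ ≤ L * ‖a‖ := by
  set Φ : A →L[ℂ] BoundedOp d := ⟨ι.toLinearMap, hA.continuous⟩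
  refine ⟨‖Φ‖ + 1, by positivity, fun k l a => ?_⟩
  have h1 : ‖entry hA k l a‖ ≤ ‖ι a (lp.single 2 l (1 : ℂ))‖ :=
    lp.norm_apply_le_norm (by simp) _ k
  have h2 : ‖ι a (lp.single 2 l (1 : ℂ))‖ ≤ ‖ι a‖ * 1 := by
    have := (ι a).le_opNorm (lp.single 2 l (1 : ℂ))
    rwa [lp.norm_single (by simp), norm_one] at this
  have h3 : ‖ι a‖ ≤ ‖Φ‖ * ‖a‖ := Φ.le_opNorm a
  nlinarith [norm_nonneg a]

/-- The Neumann series of a series of translation operators with positive coefficients is bounded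
below by the powers of each single term. -/
theorem le_entry_inv_one_sub [CompleteSpace A] (hw : ∀ m, 0 < w m)
    (hB : ∀ m k, w m * (ν m : ℝ) ^ k ≤ (1 / 2) ^ m * B k)
    (hlt : ‖translationSeries hT j w ν 0‖ < 1) (m p : ℕ) :
    ((w m ^ p : ℝ) : ℂ) ≤ entry hA (p • freq j (ν m)) 0
      (((Units.oneSub _ hlt)⁻¹ : Aˣ) : A) := by
  set f := translationSeries hT j w ν 0 with hf
  have hg : NonnegEntries hA (f - (w m : ℂ) • translation hT (freq j (ν m))) := fun k l => by
    rw [map_sub, map_smul, entry_translation, smul_eq_mul, sub_nonneg]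
    have h := hasSum_entry_translationSeries hA hT (j := j) hw hB 0 k l
    simp only [symbol_zero, mul_one] at h
    refine le_hasSum h m fun i _ => mul_nonneg (Complex.zero_le_real.2 (hw i).le) ?_
    split_ifs <;> simp
  have hf0 : NonnegEntries hA f := by
    have := hg.add hA ((nonnegEntries_translation hA hT (freq j (ν m))).smul hA (hw m).le)
    rwa [sub_add_cancel] at this
  have hsum : HasSum (fun i : ℕ => f ^ i) (((Units.oneSub _ hlt)⁻¹ : Aˣ) : A) :=
    (summable_geometric_of_norm_lt_one hlt).hasSum
  have h1 := le_hasSum (hsum.mapL (entry hA (p • freq j (ν m)) 0)) p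
    fun i _ => hf0.pow hA i _ _
  refine le_trans ?_ h1
  have h2 := nonnegEntries_pow_sub hA hT (hw m).le hg (add_sub_cancel _ _).symm p
    (p • freq j (ν m)) 0
  rw [map_sub, map_smul, entry_translation, sub_self, if_pos rfl, smul_eq_mul, mul_one,
    sub_nonneg] at h2
  exact h2

end Series

/-! ### Necessity of almost increase -/

theorem isAlmostIncreasing_of_isInverseClosed (hA : IsHomogeneousMatrixAlgebra ι)
    (hT : HasBoundedTranslations ι) [CompleteSpace A] (j : Fin d) {M : ℕ → ℝ}
    (hM : IsDefiningSequence M) (hpos : ∀ k, 0 < logConvexReg M k)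
    (hinv : IsInverseClosed (carlemanClass ι M)) :
    IsAlmostIncreasing (rootSeq (logConvexReg M)) := by
  set N := logConvexReg M with hNdef
  have hN : IsLogConvexSeq N := isLogConvexSeq_logConvexReg
  have hN0 : N 0 = 1 := logConvexReg_zero hM
  set T := translationBound hT
  have hTpos : 0 < T := translationBound_pos hT
  -- small enough for the Neumann series to converge
  set ε : ℝ := 1 / (4 * T) with hε
  have hεpos : 0 < ε := by positivity
  obtain ⟨w, ν, R, κ, hR, hκ, hw, hwB, hwlow⟩ := exists_weights hN hpos hεpos
  set B : ℕ → ℝ := fun k => ε * (R ^ k * N k) with hBdef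
  have hB : ∀ m k, w m * (ν m : ℝ) ^ k ≤ (1 / 2) ^ m * B k := fun m k =>
    (hwB m k).trans_eq (by simp only [hBdef]; ring)
  set D := translationSeries hT j w ν with hD
  have hDle : ∀ α, ‖D α‖ ≤ 1 / 2 * ((2 * Real.pi * R) ^ (∑ i, α i) * N (∑ i, α i)) := fun α => by
    refine (norm_translationSeries_le hT hw hB α).trans_eq ?_
    change 2 * ((2 * Real.pi) ^ (∑ i, α i) * (ε * (R ^ (∑ i, α i) * N (∑ i, α i))) * T) = _
    rw [hε, mul_pow (2 * Real.pi)]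
    field_simp
    norm_num
  have hlt : ‖D 0‖ < 1 := (hDle 0).trans_lt (by simp [hN0]; norm_num)
  set u : Aˣ := Units.oneSub (D 0) hlt with hu
  have humem : (u : A) ∈ carlemanClass ι M := by
    classical
    rw [mem_carlemanClass_iff hM.2]
    refine ⟨2 * Real.pi * R, by positivity, ‖(1 : A)‖ + 1 / 2, by positivity,
      fun α => (if α = 0 then 1 else 0) - D α, ?_, fun α => ?_⟩
    · refine (isDerivativeFamily_iff hA _ _).2 ⟨fun α => (continuousVectors hA).sub_mem ?_
        (translationSeries_mem hA hT hw hB α), fun α k l => ?_⟩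
      · split_ifs
        · rw [mem_continuousVectors]
          simp_rw [action_one]
          exact continuous_const
        · exact (continuousVectors hA).zero_mem
      · rw [hu, Units.val_oneSub, map_sub, map_sub, hD, entry_translationSeries hA hT hw hB α,
          mul_sub]
        congr 1
        split_ifs with h
        · rw [h, symbol_zero, one_mul]
        · rw [map_zero, entry_one]
          split_ifs with hkl
          · rw [hkl, sub_self, symbol_zero_left, zero_mul]
            exact Nat.pos_of_ne_zero fun h0 => h (eq_zero_of_sum_eq_zero h0)
          · rw [mul_zero]
    · dsimp only
      have hNM : N (∑ i, α i) ≤ M (∑ i, α i) := logConvexReg_le (fun k => (hM.2 k).le) _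
      have hMp := hM.2 (∑ i, α i)
      have h1 : ‖(if α = 0 then 1 else 0 : A)‖ ≤
          ‖(1 : A)‖ * ((2 * Real.pi * R) ^ (∑ i, α i) * M (∑ i, α i)) := by
        split_ifs with h
        · subst h; simp [hM.1]
        · rw [norm_zero]; positivity
      have h2 : ‖D α‖ ≤ 1 / 2 * ((2 * Real.pi * R) ^ (∑ i, α i) * M (∑ i, α i)) :=
        (hDle α).trans (by gcongr)
      rw [add_mul]
      exact (norm_sub_le _ _).trans (add_le_add h1 h2)
  obtain ⟨r, hr, C, hC, E, hE, hEC⟩ := (mem_carlemanClass_iff hM.2 _).1 (hinv u humem)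
  obtain ⟨L, hL, hentry⟩ := exists_norm_entry_le hA
  set Q : ℝ := L * C + 1 with hQ
  have hQ1 : 1 ≤ Q := le_add_of_nonneg_left (by positivity)
  have hQ0 : 0 < Q := by linarith
  -- a single diagonal of the inverse bounds a geometric sequence by the weight
  have hgeo : ∀ m p k : ℕ, w m ^ p * (2 * Real.pi * p * ν m / r) ^ k ≤ Q * M k := by
    intro m p k
    have h1 := le_entry_inv_one_sub hA hT hw hB hlt m p
    have h2 : w m ^ p ≤ ‖entry hA (p • freq j (ν m)) 0 ((u⁻¹ : Aˣ) : A)‖ := by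
      have := (Complex.le_def.1 h1).1
      rw [Complex.ofReal_re] at this
      exact this.trans (Complex.re_le_norm _)
    have h3 := ((isDerivativeFamily_iff hA _ E).1 hE).2 (Pi.single j k) (p • freq j (ν m)) 0
    have h4 := congrArg norm h3
    have h5 : ‖symbol (p • freq j (ν m) - 0) (Pi.single j k)‖ =
        (2 * Real.pi * p * ν m) ^ k := by
      rw [sub_zero, symbol_single, norm_pow, norm_mul, Complex.norm_intCast]
      simp [freq, abs_of_pos Real.pi_pos, mul_assoc]
    rw [norm_mul, h5] at h4
    have h6 := hEC (Pi.single j k)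
    have hsum : ∑ i, (Pi.single j k : Fin d → ℕ) i = k := by simp
    rw [hsum] at h6
    have h7 := hentry (p • freq j (ν m)) 0 (E (Pi.single j k))
    have hMk := hM.2 k
    rw [div_pow, ← mul_div_assoc, div_le_iff₀ (by positivity)]
    calc w m ^ p * (2 * Real.pi * p * ν m) ^ k
        ≤ ‖entry hA (p • freq j (ν m)) 0 ((u⁻¹ : Aˣ) : A)‖ * (2 * Real.pi * p * ν m) ^ k := by
          gcongr
      _ = ‖entry hA (p • freq j (ν m)) 0 (E (Pi.single j k))‖ := by rw [h4, mul_comm]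
      _ ≤ L * (C * (r ^ k * M k)) := h7.trans (mul_le_mul_of_nonneg_left h6 hL.le)
      _ ≤ Q * M k * r ^ k := by
          have : 0 ≤ r ^ k * M k := by positivity
          rw [hQ]; nlinarith
  have hgeoN : ∀ m p k : ℕ, w m ^ p * (2 * Real.pi * p * ν m / r) ^ k ≤ Q * N k := by
    intro m p k
    have hwm := hw m
    have h := geometric_le_logConvexReg (M := M) (c := w m ^ p / Q)
      (q := 2 * Real.pi * p * ν m / r) (by positivity) (by positivity) (fun k => by
        rw [div_mul_eq_mul_div, div_le_iff₀ hQ0, mul_comm (M k)]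
        exact hgeo m p k) k
    rw [div_mul_eq_mul_div, div_le_iff₀ hQ0, mul_comm (logConvexReg M k)] at h
    exact h
  set G : ℝ := Q * max (1 / ε) 1 * (r / (2 * Real.pi * κ)) with hG
  have hmax : 1 ≤ max (1 / ε) 1 := le_max_right _ _
  refine isAlmostIncreasing_of_multiples hN hpos hN0 (G := G) (by positivity) fun m p hm hp => ?_
  have hNm := hpos m
  have hNpm := hpos (p * m)
  have h1 := pow_le_pow_left₀ (by positivity) (hwlow m) p
  have h2 := hgeoN m p (p * m)
  have e1 : w m ^ p * (2 * Real.pi * p * ν m / r) ^ (p * m) =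
      (w m * (ν m : ℝ) ^ m) ^ p * (2 * Real.pi / r) ^ (p * m) * (p : ℝ) ^ (p * m) := by
    rw [mul_pow (w m), ← pow_mul, mul_comm m p]
    rw [show 2 * Real.pi * p * ν m / r = ν m * (2 * Real.pi / r) * p by ring, mul_pow, mul_pow]
    ring
  have e2 : (ε * κ ^ m * N m) ^ p = ε ^ p * κ ^ (p * m) * N m ^ p := by
    rw [mul_pow, mul_pow, ← pow_mul, mul_comm m p]
  rw [e1] at h2
  rw [e2] at h1
  have h3 : ε ^ p * κ ^ (p * m) * N m ^ p * (2 * Real.pi / r) ^ (p * m) * (p : ℝ) ^ (p * m) ≤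
      Q * N (p * m) := le_trans (by gcongr) h2
  have hcoef : Q * (1 / ε) ^ p ≤ (Q * max (1 / ε) 1) ^ (p * m) := by
    have hpm : p ≤ p * m := Nat.le_mul_of_pos_right p hm
    rw [mul_pow]
    refine mul_le_mul (le_self_pow₀ hQ1 (by positivity)) ?_ (by positivity) (by positivity)
    exact (pow_le_pow_left₀ (by positivity) (le_max_left _ _) p).trans
      (pow_le_pow_right₀ hmax hpm)
  calc N m ^ p * (p : ℝ) ^ (p * m)
      = (ε ^ p * κ ^ (p * m) * N m ^ p * (2 * Real.pi / r) ^ (p * m) * (p : ℝ) ^ (p * m)) *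
          ((1 / ε) ^ p * (r / (2 * Real.pi * κ)) ^ (p * m)) := by
        have a1 : ε ^ p * (1 / ε) ^ p = 1 := by
          rw [← mul_pow, mul_one_div_cancel hεpos.ne', one_pow]
        have a2 : κ ^ (p * m) * (2 * Real.pi / r) ^ (p * m) *
            (r / (2 * Real.pi * κ)) ^ (p * m) = 1 := by
          rw [← mul_pow, ← mul_pow]
          have : κ * (2 * Real.pi / r) * (r / (2 * Real.pi * κ)) = 1 := by
            field_simp
          rw [this, one_pow]
        calc _ = N m ^ p * (p : ℝ) ^ (p * m) * (ε ^ p * (1 / ε) ^ p) *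
              (κ ^ (p * m) * (2 * Real.pi / r) ^ (p * m) *
                (r / (2 * Real.pi * κ)) ^ (p * m)) := by rw [a1, a2, mul_one, mul_one]
          _ = _ := by ring
    _ ≤ Q * N (p * m) * ((1 / ε) ^ p * (r / (2 * Real.pi * κ)) ^ (p * m)) := by gcongr
    _ = Q * (1 / ε) ^ p * (r / (2 * Real.pi * κ)) ^ (p * m) * N (p * m) := by ring
    _ ≤ (Q * max (1 / ε) 1) ^ (p * m) * (r / (2 * Real.pi * κ)) ^ (p * m) * N (p * m) := by
        gcongr
    _ = G ^ (p * m) * N (p * m) := by rw [hG, mul_pow _ (r / (2 * Real.pi * κ))]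

end HomogeneousMatrixAlgebra

open HomogeneousMatrixAlgebra in
theorem mainTheorem6 {d : ℕ} {A : Type*} [NormedRing A] [NormedAlgebra ℂ A] [CompleteSpace A]
    (ι : A →ₐ[ℂ] BoundedOp d)
    (hA : IsHomogeneousMatrixAlgebra ι)
    (hT : HasBoundedTranslations ι)
    (M : ℕ → ℝ) (hM : IsDefiningSequence M)
    (hnt : CarlemanNontrivial ι) :
    (IsInverseClosed (carlemanClass ι M) ↔ IsAlmostIncreasing (rootSeq (logConvexReg M))) ∧
    (IsAlmostIncreasing (rootSeq M) → IsInverseClosed (carlemanClass ι M)) ∧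
    (IsLogConvexSeq M →
      (IsInverseClosed (carlemanClass ι M) ↔ IsAlmostIncreasing (rootSeq M))) := by
  have key : IsInverseClosed (carlemanClass ι M) ↔
      IsAlmostIncreasing (rootSeq (logConvexReg M)) := by
    by_cases hpos : ∀ k, 0 < logConvexReg M k
    · -- nontriviality only serves to exclude `d = 0`
      obtain ⟨j⟩ : Nonempty (Fin d) := by
        by_contra hempty
        exact hnt (Set.eq_univ_of_forall fun a j => (hempty ⟨j⟩).elim)
      refine ⟨isAlmostIncreasing_of_isInverseClosed hA hT j hM hpos, fun hinc => ?_⟩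
      rw [← carlemanClass_logConvexReg hA hM hpos]
      exact isInverseClosed_of_isAlmostIncreasing hA ⟨logConvexReg_zero hM, hpos⟩ hinc
    · -- otherwise the regularization is `(1, 0, 0, …)` and both sides hold
      have hz : ∀ k, logConvexReg M (k + 1) = 0 := fun k => by
        by_contra hk
        exact hpos (logConvexReg_pos_of_pos hM
          (lt_of_le_of_ne (logConvexReg_nonneg _) (Ne.symm hk)))
      refine iff_of_true (isInverseClosed_of_logConvexReg_eq_zero hA hM (hz 0))
        ⟨1, one_pos, fun k l hk hkl => ?_⟩
      have hroot : ∀ i, 1 ≤ i → rootSeq (logConvexReg M) i = 0 := fun i hi => by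
        obtain ⟨i, rfl⟩ := Nat.exists_eq_add_of_le' hi
        rw [rootSeq, hz, zero_div, Real.zero_rpow (by positivity)]
      rw [hroot k hk, hroot l (by omega), mul_zero]
  refine ⟨key, isInverseClosed_of_isAlmostIncreasing hA hM, fun hlc => ?_⟩
  rwa [logConvexReg_eq_self (fun k => (hM.2 k).le) hlc] at key
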